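/- **Proposition 7.6.** Let $(M,\omega)$ be a 2-plectic manifold, i.e. a smooth (Hausdorff, finite-dimensional) manifold with a closed 3-form $\omega$ such that $\iota_v\omega_x=0$ implies $v=0$ for $v\in T_xM$. *Lie 2-algebras.* A Lie 2-algebra is a 2-term complex of real vector spaces $L_1\xrightarrow{d}L_0$ with a skew-symmetric chain map $[\cdot,\cdot]:L_\bullet\otimes L_\bullet\to L_\bullet$ and a skew-symmetric chain homotopy $J:L_0^{\otimes 3}\to L_1$ from $[x,[y,z]]$ to $[[x,y],z]+[y,[x,z]]$ such that $$[x,J(y,z,w)]+J(x,[y,z],w)+J(x,z,[y,w])+[J(x,y,z),w]+[z,J(x,y,w)]$$ $$=J(x,y,[z,w])+J([x,y],z,w)+[y,J(x,z,w)]+J(y,[x,z],w)+J(y,z,[x,w]).$$ A morphism $L\to L'$ is a chain map $\phi$ with a skew-symmetric chain homotopy $\Phi:L_0\otimes L_0\to L_1'$ from $\phi[x,y]$ to $[\phi x,\phi y]$ such that $$\phi_1J(x,y,z)-J'(\phi_0x,\phi_0y,\phi_0z)=\Phi(x,[y,z])-\Phi([x,y],z)-\Phi(y,[x,z])-[\Phi(x,y),\phi_0z]+[\phi_0x,\Phi(y,z)]-[\phi_0y,\Phi(x,z)].$$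 An isomorphism is a morphism with a two-sided inverse morphism; the composite of $(\phi,\Phi)$ followed by $(\psi,\Psi)$ is $(\psi\phi,\ \psi_1\Phi(x,y)+\Psi(\phi_0x,\phi_0y))$. *The Lie 2-algebra $L_\infty(M,\omega)$.* A 1-form $\alpha$ is Hamiltonian if $d\alpha=-\iota_{v_\alpha}\omega$ for a (necessarily unique) vector field $v_\alpha$. $L_\infty(M,\omega)$ is the complex $d:C^\infty(M)\to\Omega^1_{\mathrm{Ham}}(M)$ with $[\alpha,\beta]=\iota_{v_\beta}\iota_{v_\alpha}\omega$ in degree 0, zero bracket in degree 1, and $J(\alpha,\beta,\gamma)=\iota_{v_\alpha}\iota_{v_\beta}\iota_{v_\gamma}\omega$. *The Lie 2-algebra $L_\infty(C)^s$.* A Courant algebroid is a vector bundle $C\to M$ with a nondegenerate symmetric bilinear form $\langle\cdot,\cdot\rangle$, a bundle map $\rho:C\to TM$ and a skew-symmetric bracket $[\![\cdot,\cdot]\!]_C$ on $\Gamma(C)$ such that, with $D=\rho^*d$ (i.e. $\langle Df,e\rangle=\rho(e)f$) and $T(e_1,e_2,e_3)=\frac16\big(\langle[\![e_1,e_2]\!]_C,e_3\rangle+\langle[\![e_3,e_1]\!]_C,e_2\rangle+\langle[\![e_2,e_3]\!]_C,e_1\rangle\big)$,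 - $[\![e_1,[\![e_2,e_3]\!]_C]\!]_C-[\![[\![e_1,e_2]\!]_C,e_3]\!]_C-[\![e_2,[\![e_1,e_3]\!]_C]\!]_C=-D\,T(e_1,e_2,e_3)$; - $\rho[\![e_1,e_2]\!]_C=[\rho e_1,\rho e_2]$; - $[\![e_1,fe_2]\!]_C=f[\![e_1,e_2]\!]_C+\rho(e_1)(f)\,e_2-\frac12\langle e_1,e_2\rangle Df$; - $\langle Df,Dg\rangle=0$; - $\rho(e_1)\langle e_2,e_3\rangle=\langle[\![e_1,e_2]\!]_D,e_3\rangle+\langle e_2,[\![e_1,e_3]\!]_D\rangle$, where $[\![e,e']\!]_D=[\![e,e']\!]_C+\frac12D\langle e,e'\rangle$ is the Dorfman bracket. It is exact if $0\to T^*M\xrightarrow{\rho^*}C\xrightarrow{\rho}TM\to0$ is exact. A splitting is a smooth bundle map $s:TM\to C$ with $\rho s=\mathrm{id}$ and isotropic image; its curvature is the 3-form $\langle[\![s(v_1),s(v_2)]\!]_C,s(v_3)\rangle$. Given such $C$ and $s$, let $\Gamma(C)^s$ be the space of sections $e$ that preserve the splitting, i.e. $[\![e,s(v')]\!]_D=s([\rho(e),v'])$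 for all vector fields $v'$. $L_\infty(C)$ is the complex $D:C^\infty(M)\to\Gamma(C)$ with bracket $[\![\cdot,\cdot]\!]_C$ in degree 0, $[e,f]=\frac12\langle e,Df\rangle$ in degree 1, and $J=-T$; $L_\infty(C)^s$ is its restriction to $D:C^\infty(M)\to\Gamma(C)^s$. *Claim.* There is an exact Courant algebroid over $M$, on the bundle $TM\oplus T^*M$, with a splitting of curvature $-\omega$. For every exact Courant algebroid $C$ over $M$ and every splitting $s$ of $C$ with curvature $-\omega$, both $L_\infty(M,\omega)$ and $L_\infty(C)^s$ are Lie 2-algebras, and they are isomorphic as Lie 2-algebras. -/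

import Mathlib

open scoped Manifold ContDiff Bundle

set_option linter.unusedSectionVars false

noncomputable section

namespace TwoPlectic

section VectorFields

variable {E : Type*} [NormedAddCommGroup E] [NormedSpace ℝ E]
  {M : Type*} [TopologicalSpace M] [ChartedSpace E M] [IsManifold 𝓘(ℝ, E) ∞ M]

variable (E M) in
/-- The algebra `C^∞(M)` of smooth real functions. -/
abbrev Fn : Type _ := C^∞⟮𝓘(ℝ, E), M; ℝ⟯

variable (E M) in
/-- The space `𝔛(M)` of smooth vector fields. -/
abbrev VField : Type _ := Cₛ^∞⟮𝓘(ℝ, E); E, (TangentSpace 𝓘(ℝ, E) : M → Type _)⟯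

variable (E) in
/-- The differential `(df)_x : T_x M → ℝ`. -/
abbrev diff (f : M → ℝ) (x : M) : TangentSpace 𝓘(ℝ, E) x →L[ℝ] ℝ := mvfderiv 𝓘(ℝ, E) f x

theorem contMDiff_diff (X : VField E M) (f : Fn E M) :
    ContMDiff 𝓘(ℝ, E) 𝓘(ℝ, ℝ) ∞ (fun x => diff E f x (X x)) := by
  have h1 := (f.contMDiff.contMDiff_tangentMap (m := ∞) (by simp)).comp X.contMDiff
  have h2 := (contMDiff_snd_tangentBundle_modelSpace ℝ 𝓘(ℝ, ℝ) (n := ∞)).comp h1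
  exact h2

/-- The derivative `X(f)` of a function along a vector field. -/
def act (X : VField E M) (f : Fn E M) : Fn E M := ⟨_, contMDiff_diff X f⟩

@[simp] theorem act_apply (X : VField E M) (f : Fn E M) (x : M) :
    act X f x = diff E f x (X x) := rfl

theorem act_add (X : VField E M) (f g : Fn E M) : act X (f + g) = act X f + act X g := by
  ext x
  have := mvfderiv_add (I := 𝓘(ℝ, E)) (x := x) f.mdifferentiableAt g.mdifferentiableAt
  simp [diff, this]

theorem act_mul (X : VField E M) (f g : Fn E M) :
    act X (f * g) = f * act X g + g * act X f := by
  ext x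
  have := mvfderiv_mul (I := 𝓘(ℝ, E)) (x := x) f.mdifferentiableAt g.mdifferentiableAt
  simp [diff, this]


theorem diff_smul (c : ℝ) (f : Fn E M) (x : M) (v : TangentSpace 𝓘(ℝ, E) x) :
    diff E (c • f : Fn E M) x v = c * diff E f x v := by
  have := mvfderiv_smul (I := 𝓘(ℝ, E)) (x := x) (a := fun _ : M => c) mdifferentiableAt_const
    f.mdifferentiableAt
  have h3 := congrArg (fun L => L v) this
  simp only [mvfderiv_const] at h3
  have h4 : ((c • f : Fn E M) : M → ℝ) = (fun _ : M => c) * ⇑f := rfl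
  rw [h4]
  simpa [diff] using h3

theorem act_smul (X : VField E M) (c : ℝ) (f : Fn E M) : act X (c • f) = c • act X f := by
  ext x
  exact diff_smul c f x (X x)

theorem act_neg (X : VField E M) (f : Fn E M) : act X (-f) = -act X f := by
  simpa using act_smul X (-1) f

theorem act_sub (X : VField E M) (f g : Fn E M) : act X (f - g) = act X f - act X g := by
  rw [sub_eq_add_neg, act_add, act_neg, sub_eq_add_neg]

/-- `X(f)` is additive in `X`. -/
theorem act_add_left (X Y : VField E M) (f : Fn E M) : act (X + Y) f = act X f + act Y f := by
  ext x; simp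

theorem act_smul_left (c : ℝ) (X : VField E M) (f : Fn E M) : act (c • X) f = c • act X f := by
  ext x; simp

theorem act_neg_left (X : VField E M) (f : Fn E M) : act (-X) f = -act X f := by
  ext x; simp

theorem act_zero_left (f : Fn E M) : act (0 : VField E M) f = 0 := by
  ext x; simp

/-- The product of a smooth function and a smooth section of a vector bundle. -/
def fsmul {F : Type*} [NormedAddCommGroup F] [NormedSpace ℝ F] {V : M → Type*}
    [TopologicalSpace (Bundle.TotalSpace F V)] [∀ x, TopologicalSpace (V x)]
    [∀ x, AddCommGroup (V x)] [∀ x, Module ℝ (V x)] [FiberBundle F V] [VectorBundle ℝ F V]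
    (f : Fn E M) (e : Cₛ^∞⟮𝓘(ℝ, E); F, V⟯) : Cₛ^∞⟮𝓘(ℝ, E); F, V⟯ :=
  ⟨fun x => f x • e x, ContMDiff.smul_section f.contMDiff e.contMDiff⟩

variable [FiniteDimensional ℝ E]

/-- Through every vector of a smooth vector bundle passes a global smooth section. -/
theorem exists_section [T2Space M] {F : Type*} [NormedAddCommGroup F] [NormedSpace ℝ F]
    {V : M → Type*}
    [TopologicalSpace (Bundle.TotalSpace F V)] [∀ x, TopologicalSpace (V x)]
    [∀ x, AddCommGroup (V x)] [∀ x, Module ℝ (V x)] [FiberBundle F V] [VectorBundle ℝ F V]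
    [ContMDiffVectorBundle ∞ F V 𝓘(ℝ, E)] (x : M) (v : V x) :
    ∃ e : Cₛ^∞⟮𝓘(ℝ, E); F, V⟯, e x = v := by
  obtain ⟨s, hs, hsm⟩ := FiberBundle.exists_contMDiffOn_extend 𝓘(ℝ, E) F (k := ∞) v
  obtain ⟨u, hus, huo, hxu⟩ := mem_nhds_iff.1 hs
  obtain ⟨ψ, hψ⟩ := ((SmoothBumpFunction.nhds_basis_tsupport (I := 𝓘(ℝ, E)) x).mem_iff).1
    (huo.mem_nhds hxu)
  refine ⟨⟨(ψ : M → ℝ) • FiberBundle.extend F v,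
    ContMDiffOn.smul_section_of_tsupport ψ.contMDiff.contMDiffOn huo hψ.2 (hsm.mono hus)⟩, ?_⟩
  simp

/-- The Lie bracket `[X, Y]` of vector fields. -/
def lie (X Y : VField E M) : VField E M :=
  ⟨VectorField.mlieBracket 𝓘(ℝ, E) X Y, by
    have : CompleteSpace E := FiniteDimensional.complete ℝ E
    have : IsManifold 𝓘(ℝ, E) ((⊤ : ℕ∞) + 1) M := by simpa using ‹IsManifold 𝓘(ℝ, E) ∞ M›
    have : IsManifold 𝓘(ℝ, E) (minSmoothness ℝ 2) M := by
      simp only [minSmoothness_of_isRCLikeNormedField]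
      exact IsManifold.of_le (n := ∞) (WithTop.coe_le_coe.2 (le_top : (2 : ℕ∞) ≤ ⊤))
    exact ContDiff.mlieBracket_vectorField (n := ⊤) (m := ⊤) X.contMDiff Y.contMDiff (by simp)⟩

theorem lie_skew (X Y : VField E M) : lie X Y = -lie Y X := by
  ext x
  exact VectorField.mlieBracket_swap_apply ..

theorem lie_add_right (X Y Z : VField E M) : lie X (Y + Z) = lie X Y + lie X Z := by
  ext x
  have : CompleteSpace E := FiniteDimensional.complete ℝ E
  exact VectorField.mlieBracket_add_right Y.mdifferentiableAt Z.mdifferentiableAt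

theorem lie_smul_right (c : ℝ) (X Y : VField E M) : lie X (c • Y) = c • lie X Y := by
  ext x
  have : CompleteSpace E := FiniteDimensional.complete ℝ E
  exact VectorField.mlieBracket_const_smul_right Y.mdifferentiableAt

theorem lie_add_left (X Y Z : VField E M) : lie (X + Y) Z = lie X Z + lie Y Z := by
  rw [lie_skew, lie_add_right, lie_skew Z X, lie_skew Z Y]; abel

theorem lie_smul_left (c : ℝ) (X Y : VField E M) : lie (c • X) Y = c • lie X Y := by
  rw [lie_skew, lie_smul_right, lie_skew Y X, smul_neg, neg_neg]

theorem lie_fsmul_right (f : Fn E M) (X Y : VField E M) :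
    lie X (fsmul f Y) = fsmul (act X f) Y + fsmul f (lie X Y) := by
  ext x
  have : CompleteSpace E := FiniteDimensional.complete ℝ E
  exact VectorField.mlieBracket_smul_right (I := 𝓘(ℝ, E)) (f := f) (V := X) (W := Y)
    f.mdifferentiableAt Y.mdifferentiableAt

/-- The Jacobi identity for the Lie bracket of vector fields. -/
theorem lie_jacobi (X Y Z : VField E M) :
    lie X (lie Y Z) = lie (lie X Y) Z + lie Y (lie X Z) := by
  ext x
  have : CompleteSpace E := FiniteDimensional.complete ℝ E
  have : IsManifold 𝓘(ℝ, E) (minSmoothness ℝ 3) M := by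
    simp only [minSmoothness_of_isRCLikeNormedField]
    exact IsManifold.of_le (n := ∞) (WithTop.coe_le_coe.2 (le_top : (3 : ℕ∞) ≤ ⊤))
  have h : ∀ W : VField E M, ContMDiffAt 𝓘(ℝ, E) (𝓘(ℝ, E).prod 𝓘(ℝ, E)) (minSmoothness ℝ 2)
      (fun y => (⟨y, W y⟩ : TangentBundle 𝓘(ℝ, E) M)) x := fun W =>
    (W.contMDiff x).of_le (by
      simp only [minSmoothness_of_isRCLikeNormedField]; exact WithTop.coe_le_coe.2 (le_top : (2 : ℕ∞) ≤ ⊤))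
  exact VectorField.leibniz_identity_mlieBracket_apply (h X) (h Y) (h Z)

theorem lie_aux {W : Type*} [AddCommGroup W] [Module ℝ W] {a b c d g f : ℝ}
    {v p q r t : W}
    (h : a • v + b • p + (c • q + f • (r + t)) = d • v + f • r + (g • v + c • q + (b • p + f • t))) :
    (d - (a - g)) • v = 0 := by
  linear_combination (norm := module) -h

/-- `[X, Y](f) = X(Y(f)) - Y(X(f))`. -/
theorem act_lie [T2Space M] (X Y : VField E M) (f : Fn E M) :
    act (lie X Y) f = act X (act Y f) - act Y (act X f) := by
  ext x
  by_cases hE : ∃ v : TangentSpace 𝓘(ℝ, E) x, v ≠ 0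
  · obtain ⟨v, hv⟩ := hE
    obtain ⟨Z, hZ⟩ := exists_section (E := E) (F := E) (V := (TangentSpace 𝓘(ℝ, E) : M → Type _)) x v
    have h := lie_jacobi X Y (fsmul f Z)
    simp only [lie_fsmul_right, lie_add_right] at h
    have h' := congrArg (fun W : VField E M => W x) h
    have hj := congrArg (fun W : VField E M => W x) (lie_jacobi X Y Z)
    simp only [fsmul, ContMDiffSection.coe_add, Pi.add_apply, ContMDiffSection.coeFn_mk] at h' hj
    rw [hj, hZ] at h'
    have h3 : (act (lie X Y) f x - (act X (act Y f) x - act Y (act X f) x)) • v = 0 := by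
      exact lie_aux h'
    rcases smul_eq_zero.1 h3 with h4 | h4
    · simpa [sub_eq_zero] using h4
    · exact absurd h4 hv
  · push Not at hE
    simp only [ContMDiffMap.coe_sub, Pi.sub_apply, act_apply]
    rw [hE (lie X Y x), hE (X x), hE (Y x)]
    simp

end VectorFields


section Forms

variable {E : Type*} [NormedAddCommGroup E] [NormedSpace ℝ E] [FiniteDimensional ℝ E]
  {M : Type*} [TopologicalSpace M] [ChartedSpace E M] [IsManifold 𝓘(ℝ, E) ∞ M]

variable (E M) in
/-- The space `Ω¹(M)` of smooth 1-forms: families of covectors `α_x ∈ T_x^* M` that are smooth, that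
is, `x ↦ α_x(X_x)` is smooth for every smooth vector field `X`. -/
def oneFormSubmodule : Submodule ℝ (∀ x : M, TangentSpace 𝓘(ℝ, E) x →L[ℝ] ℝ) where
  carrier := {α | ∀ X : VField E M, ContMDiff 𝓘(ℝ, E) 𝓘(ℝ, ℝ) ∞ (fun x => α x (X x))}
  add_mem' ha hb X := (ha X).add (hb X)
  zero_mem' _ := contMDiff_const
  smul_mem' _ _ ha X := contMDiff_const.mul (ha X)

variable (E M) in
/-- The real vector space `Ω¹(M)` of smooth 1-forms. -/
def OneForm : Type _ := oneFormSubmodule E M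

instance : AddCommGroup (OneForm E M) := inferInstanceAs (AddCommGroup (oneFormSubmodule E M))

instance : Module ℝ (OneForm E M) := inferInstanceAs (Module ℝ (oneFormSubmodule E M))

/-- The function `α(X)`. -/
def OneForm.ev (α : OneForm E M) (X : VField E M) : Fn E M := ⟨fun x => α.1 x (X x), α.2 X⟩

@[simp] theorem OneForm.ev_apply (α : OneForm E M) (X : VField E M) (x : M) :
    OneForm.ev α X x = α.1 x (X x) := rfl

theorem OneForm.ext_pt {α β : OneForm E M} (h : ∀ x v, α.1 x v = β.1 x v) : α = β :=
  Subtype.ext (funext fun x => ContinuousLinearMap.ext (h x))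

variable (E M) in
/-- The de Rham differential `d : C^∞(M) → Ω¹(M)`. -/
def deRham : Fn E M →ₗ[ℝ] OneForm E M where
  toFun f := ⟨fun x => diff E f x, fun X => contMDiff_diff X f⟩
  map_add' f g := by
    refine OneForm.ext_pt fun x v => ?_
    have := mvfderiv_add (I := 𝓘(ℝ, E)) (x := x) f.mdifferentiableAt g.mdifferentiableAt
    exact congrArg (fun L => L v) this
  map_smul' c f := by
    refine OneForm.ext_pt fun x v => ?_
    exact diff_smul c f x v

/-- The exterior derivative of a 1-form, evaluated on vector fields:
`dα(X, Y) = X(α(Y)) - Y(α(X)) - α([X, Y])`. -/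
def OneForm.extDeriv (α : OneForm E M) (X Y : VField E M) : Fn E M :=
  act X (OneForm.ev α Y) - act Y (OneForm.ev α X) - OneForm.ev α (lie X Y)

variable (E M) in
/-- Smooth 3-forms: families of alternating trilinear forms `ω_x` on `T_x M` such that
`x ↦ ω_x(X_x, Y_x, Z_x)` is smooth for all smooth vector fields `X, Y, Z`. -/
structure ThreeForm where
  /-- The value of the form at a point. -/
  toFun : ∀ x : M, TangentSpace 𝓘(ℝ, E) x [⋀^Fin 3]→L[ℝ] ℝ
  smooth : ∀ X Y Z : VField E M,
    ContMDiff 𝓘(ℝ, E) 𝓘(ℝ, ℝ) ∞ (fun x => toFun x ![X x, Y x, Z x])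

/-- The function `Ω(X, Y, Z)`. -/
def ThreeForm.ev (Ω : ThreeForm E M) (X Y Z : VField E M) : Fn E M :=
  ⟨fun x => Ω.toFun x ![X x, Y x, Z x], Ω.smooth X Y Z⟩

@[simp] theorem ThreeForm.ev_apply (Ω : ThreeForm E M) (X Y Z : VField E M) (x : M) :
    Ω.ev X Y Z x = Ω.toFun x ![X x, Y x, Z x] := rfl

/-- The exterior derivative of a 3-form, evaluated on vector fields by the invariant formula
`dΩ(X₀, …, X₃) = ∑ᵢ (-1)ⁱ Xᵢ(Ω(…, X̂ᵢ, …)) + ∑_{i<j} (-1)^{i+j} Ω([Xᵢ, Xⱼ], …, X̂ᵢ, …, X̂ⱼ, …)`. -/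
def ThreeForm.extDeriv (Ω : ThreeForm E M) (X₀ X₁ X₂ X₃ : VField E M) : Fn E M :=
  act X₀ (Ω.ev X₁ X₂ X₃) - act X₁ (Ω.ev X₀ X₂ X₃) + act X₂ (Ω.ev X₀ X₁ X₃)
    - act X₃ (Ω.ev X₀ X₁ X₂)
    - Ω.ev (lie X₀ X₁) X₂ X₃ + Ω.ev (lie X₀ X₂) X₁ X₃ - Ω.ev (lie X₀ X₃) X₁ X₂
    - Ω.ev (lie X₁ X₂) X₀ X₃ + Ω.ev (lie X₁ X₃) X₀ X₂ - Ω.ev (lie X₂ X₃) X₀ X₁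

/-- A 3-form is closed if `dΩ = 0`. -/
def ThreeForm.IsClosed (Ω : ThreeForm E M) : Prop := ∀ X Y Z W, Ω.extDeriv X Y Z W = 0

/-- A 3-form is nondegenerate if `ι_v ω_x = 0` implies `v = 0`, for every tangent vector `v`. -/
def ThreeForm.IsNondegenerate (Ω : ThreeForm E M) : Prop :=
  ∀ (x : M) (v : TangentSpace 𝓘(ℝ, E) x), (∀ u w, Ω.toFun x ![v, u, w] = 0) → v = 0

/-- A 2-plectic structure: a closed and nondegenerate 3-form. -/
structure ThreeForm.IsTwoPlectic (Ω : ThreeForm E M) : Prop where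
  closed : Ω.IsClosed
  nondegenerate : Ω.IsNondegenerate

/-- The 1-form `ι_w ι_v Ω = Ω(v, w, ·)`. -/
def ThreeForm.contract (Ω : ThreeForm E M) (v w : VField E M) : OneForm E M :=
  ⟨fun x => (Ω.toFun x).toContinuousLinearMap ![v x, w x, 0] 2, fun X => by
    refine (Ω.smooth v w X).congr fun x => ?_
    simp only [ContinuousAlternatingMap.toContinuousLinearMap]
    exact congrArg (Ω.toFun x) (by ext i; fin_cases i <;> rfl)⟩

@[simp] theorem ThreeForm.contract_ev (Ω : ThreeForm E M) (v w X : VField E M) :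
    OneForm.ev (Ω.contract v w) X = Ω.ev v w X := by
  ext x
  exact congrArg (Ω.toFun x) (by ext i; fin_cases i <;> rfl)

theorem OneForm.ext_ev [T2Space M] {α β : OneForm E M}
    (h : ∀ X, OneForm.ev α X = OneForm.ev β X) : α = β := by
  refine OneForm.ext_pt fun x v => ?_
  obtain ⟨X, rfl⟩ := exists_section (E := E) (F := E)
    (V := (TangentSpace 𝓘(ℝ, E) : M → Type _)) x v
  exact congrArg (fun g : Fn E M => g x) (h X)

variable (α β : OneForm E M) (Ω : ThreeForm E M) (X Y Z W : VField E M) (c : ℝ)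

theorem OneForm.ev_add_left : OneForm.ev (α + β) X = OneForm.ev α X + OneForm.ev β X := rfl
theorem OneForm.ev_smul_left : OneForm.ev (c • α) X = c • OneForm.ev α X := rfl
theorem OneForm.ev_add : OneForm.ev α (X + Y) = OneForm.ev α X + OneForm.ev α Y := by ext x; simp
theorem OneForm.ev_smul : OneForm.ev α (c • X) = c • OneForm.ev α X := by ext x; simp
theorem OneForm.ev_deRham (f : Fn E M) : OneForm.ev (deRham E M f) X = act X f := rfl

/-- `α` as a linear map on vector fields. -/
def evLin : VField E M →ₗ[ℝ] Fn E M where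
  toFun := OneForm.ev α
  map_add' := OneForm.ev_add α
  map_smul' c X := OneForm.ev_smul α X c

namespace ThreeForm

theorem ev_swap12 : Ω.ev X Y Z = -Ω.ev Y X Z := by
  ext x
  have := (Ω.toFun x).toAlternatingMap.map_swap ![Y x, X x, Z x] (i := 0) (j := 1) (by decide)
  refine Eq.trans (congrArg (Ω.toFun x) ?_) this
  ext i; fin_cases i <;> rfl

theorem ev_swap23 : Ω.ev X Y Z = -Ω.ev X Z Y := by
  ext x
  have := (Ω.toFun x).toAlternatingMap.map_swap ![X x, Z x, Y x] (i := 1) (j := 2) (by decide)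
  refine Eq.trans (congrArg (Ω.toFun x) ?_) this
  ext i; fin_cases i <;> rfl

theorem ev_add1 : Ω.ev (X + Y) Z W = Ω.ev X Z W + Ω.ev Y Z W := by
  ext x
  exact (Ω.toFun x).vecCons_add _ _ _

theorem ev_smul1 : Ω.ev (c • X) Y Z = c • Ω.ev X Y Z := by
  ext x
  exact (Ω.toFun x).vecCons_smul _ _ _

theorem ev_add2 : Ω.ev Z (X + Y) W = Ω.ev Z X W + Ω.ev Z Y W := by
  rw [ev_swap12, ev_add1, ev_swap12 _ X, ev_swap12 _ Y]; ring

theorem ev_smul2 : Ω.ev X (c • Y) Z = c • Ω.ev X Y Z := by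
  rw [ev_swap12, ev_smul1, ev_swap12 _ Y, smul_neg, neg_neg]

theorem ev_add3 : Ω.ev Z W (X + Y) = Ω.ev Z W X + Ω.ev Z W Y := by
  rw [ev_swap23, ev_add2, ev_swap23 _ _ X, ev_swap23 _ _ Y]; ring

theorem ev_smul3 : Ω.ev X Y (c • Z) = c • Ω.ev X Y Z := by
  rw [ev_swap23, ev_smul2, ev_swap23 _ _ Z, smul_neg, neg_neg]

theorem ev_neg1 : Ω.ev (-X) Y Z = -Ω.ev X Y Z := by
  simpa using Ω.ev_smul1 X Y Z (-1)

variable {Ω}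

/-- If `dA = -ι_a Ω` for a potential `A`, then `Ω` is invariant under `a`. -/
theorem IsClosed.lie_eq [T2Space M] (hΩ : Ω.IsClosed) (A : VField E M →ₗ[ℝ] Fn E M)
    (a : VField E M)
    (h : ∀ X Y, act X (A Y) - act Y (A X) - A (lie X Y) = -Ω.ev a X Y) (X Y Z : VField E M) :
    act a (Ω.ev X Y Z) = Ω.ev (lie a X) Y Z + Ω.ev X (lie a Y) Z + Ω.ev X Y (lie a Z) := by
  have h' : ∀ X Y, Ω.ev a X Y = -(act X (A Y) - act Y (A X) - A (lie X Y)) := fun X Y => by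
    rw [h, neg_neg]
  have hc := hΩ a X Y Z
  have hj := congrArg A (lie_jacobi X Y Z)
  rw [map_add] at hj
  unfold extDeriv at hc
  rw [Ω.ev_swap12 (lie X Y) a, Ω.ev_swap12 (lie X Z) a, Ω.ev_swap12 (lie Y Z) a,
    h' Y Z, h' X Z, h' X Y, h' (lie X Y), h' (lie X Z), h' (lie Y Z)] at hc
  simp only [act_neg, act_sub, act_lie] at hc
  have f1 := Ω.ev_swap12 X (lie a Y) Z
  have f2 := (Ω.ev_swap23 X Y (lie a Z)).trans (congrArg _ (Ω.ev_swap12 X (lie a Z) Y))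
  have s3 := congrArg A (lie_skew (lie Y Z) X)
  have s4 := congrArg A (lie_skew (lie X Z) Y)
  rw [map_neg] at s3 s4
  linear_combination hc + s4 - s3 + hj - f1 - f2

/-- If `dA = -ι_a Ω` and `dB = -ι_b Ω`, then `d(ι_b ι_a Ω) = -ι_{[a,b]} Ω`. -/
theorem IsClosed.extDeriv_contract [T2Space M] (hΩ : Ω.IsClosed) (A B : VField E M →ₗ[ℝ] Fn E M)
    (a b : VField E M)
    (hA : ∀ X Y, act X (A Y) - act Y (A X) - A (lie X Y) = -Ω.ev a X Y)
    (hB : ∀ X Y, act X (B Y) - act Y (B X) - B (lie X Y) = -Ω.ev b X Y) (X Y : VField E M) :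
    act X (Ω.ev a b Y) - act Y (Ω.ev a b X) - Ω.ev a b (lie X Y) = -Ω.ev (lie a b) X Y := by
  have hc := hΩ a b X Y
  unfold extDeriv at hc
  rw [hΩ.lie_eq A a hA, hΩ.lie_eq B b hB, lie_skew b a, ev_neg1] at hc
  have e1 := Ω.ev_swap12 (lie a X) b Y
  have e2 := (Ω.ev_swap12 (lie a Y) b X).trans (congrArg _ (Ω.ev_swap23 b (lie a Y) X))
  have e3 := Ω.ev_swap12 (lie b X) a Y
  have e4 := (Ω.ev_swap12 (lie b Y) a X).trans (congrArg _ (Ω.ev_swap23 a (lie b Y) X))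
  have e5 := (Ω.ev_swap12 (lie X Y) a b).trans (congrArg _ (Ω.ev_swap23 a (lie X Y) b))
  rw [e1, e2, e3, e4, e5] at hc
  linear_combination hc

end ThreeForm

end Forms


section LieTwo

/-- A trilinear map from a trilinear function. -/
def mkTri {A B C D : Type*} [AddCommGroup A] [Module ℝ A] [AddCommGroup B] [Module ℝ B]
    [AddCommGroup C] [Module ℝ C] [AddCommGroup D] [Module ℝ D] (f : A → B → C → D)
    (h1 : ∀ a a' b c, f (a + a') b c = f a b c + f a' b c)
    (h1' : ∀ (r : ℝ) a b c, f (r • a) b c = r • f a b c)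
    (h2 : ∀ a b b' c, f a (b + b') c = f a b c + f a b' c)
    (h2' : ∀ (r : ℝ) a b c, f a (r • b) c = r • f a b c)
    (h3 : ∀ a b c c', f a b (c + c') = f a b c + f a b c')
    (h3' : ∀ (r : ℝ) a b c, f a b (r • c) = r • f a b c) : A →ₗ[ℝ] B →ₗ[ℝ] C →ₗ[ℝ] D where
  toFun a := LinearMap.mk₂ ℝ (f a) (h2 a) (fun r b c => h2' r a b c) (h3 a)
    (fun r b c => h3' r a b c)
  map_add' a a' := by ext b c; exact h1 a a' b c
  map_smul' r a := by ext b c; exact h1' r a b c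

/-- The operations of a Lie 2-algebra on a 2-term complex `L₁ → L₀` of real vector spaces: the
differential, the bracket on `L₀ ⊗ L₀`, the bracket on `L₀ ⊗ L₁` and the Jacobiator. The bracket on
`L₁ ⊗ L₀` is `[f, x] = -[x, f]`, and the bracket on `L₁ ⊗ L₁` vanishes for degree reasons. No laws
besides multilinearity are imposed here, see `LieTwoOps.IsLieTwoAlgebra`. -/
structure LieTwoOps (L₀ L₁ : Type*) [AddCommGroup L₀] [Module ℝ L₀] [AddCommGroup L₁]
    [Module ℝ L₁] where
  /-- The differential. -/
  d : L₁ →ₗ[ℝ] L₀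
  /-- The bracket in degree 0. -/
  br : L₀ →ₗ[ℝ] L₀ →ₗ[ℝ] L₀
  /-- The bracket in degree 1. -/
  br₁ : L₀ →ₗ[ℝ] L₁ →ₗ[ℝ] L₁
  /-- The Jacobiator. -/
  J : L₀ →ₗ[ℝ] L₀ →ₗ[ℝ] L₀ →ₗ[ℝ] L₁

namespace LieTwoOps

variable {L₀ L₁ L₀' L₁' : Type*} [AddCommGroup L₀] [Module ℝ L₀] [AddCommGroup L₁] [Module ℝ L₁]
  [AddCommGroup L₀'] [Module ℝ L₀'] [AddCommGroup L₁'] [Module ℝ L₁']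

/-- The laws of a Lie 2-algebra. -/
structure IsLieTwoAlgebra (L : LieTwoOps L₀ L₁) : Prop where
  /-- The bracket is skew-symmetric. -/
  skew : ∀ x y, L.br x y = -L.br y x
  /-- The bracket is a chain map, in degree 1: `d[x, f] = [x, df]`. -/
  d_br₁ : ∀ x f, L.d (L.br₁ x f) = L.br x (L.d f)
  /-- The bracket is a chain map, in degree 2: `[df, g] = [f, dg]`, where `[f, x] = -[x, f]`. -/
  br₁_d : ∀ f g, L.br₁ (L.d f) g = -L.br₁ (L.d g) f
  /-- The Jacobiator is skew-symmetric. -/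
  J_skew₁₂ : ∀ x y z, L.J x y z = -L.J y x z
  J_skew₂₃ : ∀ x y z, L.J x y z = -L.J x z y
  /-- The Jacobiator is a chain homotopy from `[x, [y, z]]` to `[[x, y], z] + [y, [x, z]]`, in
  degree 0. -/
  d_J : ∀ x y z, L.br x (L.br y z) - (L.br (L.br x y) z + L.br y (L.br x z)) = L.d (L.J x y z)
  /-- The Jacobiator is a chain homotopy, in degree 1. -/
  J_d : ∀ x y f, L.br₁ x (L.br₁ y f) - (L.br₁ (L.br x y) f + L.br₁ y (L.br₁ x f)) = L.J x y (L.d f)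
  /-- The coherence law of the Jacobiator; the summand `[J(x, y, z), w]` is `-[w, J(x, y, z)]`. -/
  coherence : ∀ x y z w,
    L.br₁ x (L.J y z w) + L.J x (L.br y z) w + L.J x z (L.br y w) - L.br₁ w (L.J x y z)
        + L.br₁ z (L.J x y w)
      = L.J x y (L.br z w) + L.J (L.br x y) z w + L.br₁ y (L.J x z w) + L.J y (L.br x z) w
        + L.J y z (L.br x w)

/-- The restriction of the operations to a subspace of `L₀` that contains the image of `d` and is
closed under the bracket. -/
def restrict (L : LieTwoOps L₀ L₁) (S : Submodule ℝ L₀) (hd : ∀ f, L.d f ∈ S)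
    (hbr : ∀ x ∈ S, ∀ y ∈ S, L.br x y ∈ S) : LieTwoOps S L₁ where
  d := L.d.codRestrict S hd
  br := LinearMap.mk₂ ℝ (fun x y => ⟨L.br x y, hbr x x.2 y y.2⟩)
    (fun a b c => Subtype.ext (by simp)) (fun r a b => Subtype.ext (by simp))
    (fun a b c => Subtype.ext (by simp)) (fun r a b => Subtype.ext (by simp))
  br₁ := L.br₁ ∘ₗ S.subtype
  J := mkTri (fun x y z => L.J x y z) (by simp) (by simp) (by simp) (by simp) (by simp) (by simp)

/-- A morphism of Lie 2-algebras: a chain map `φ` and a skew-symmetric chain homotopy `Φ` from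
`φ[x, y]` to `[φ x, φ y]`, subject to the coherence law. -/
structure Hom (L : LieTwoOps L₀ L₁) (L' : LieTwoOps L₀' L₁') where
  /-- The chain map in degree 0. -/
  φ₀ : L₀ →ₗ[ℝ] L₀'
  /-- The chain map in degree 1. -/
  φ₁ : L₁ →ₗ[ℝ] L₁'
  /-- The chain homotopy. -/
  Φ : L₀ →ₗ[ℝ] L₀ →ₗ[ℝ] L₁'
  comm : ∀ f, φ₀ (L.d f) = L'.d (φ₁ f)
  skew : ∀ x y, Φ x y = -Φ y x
  homotopy₀ : ∀ x y, φ₀ (L.br x y) - L'.br (φ₀ x) (φ₀ y) = L'.d (Φ x y)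
  homotopy₁ : ∀ x f, φ₁ (L.br₁ x f) - L'.br₁ (φ₀ x) (φ₁ f) = Φ x (L.d f)
  /-- The coherence law; the summand `[Φ(x, y), φ z]` is `-[φ z, Φ(x, y)]`. -/
  coherence : ∀ x y z,
    φ₁ (L.J x y z) - L'.J (φ₀ x) (φ₀ y) (φ₀ z)
      = Φ x (L.br y z) - Φ (L.br x y) z - Φ y (L.br x z) + L'.br₁ (φ₀ z) (Φ x y)
        + L'.br₁ (φ₀ x) (Φ y z) - L'.br₁ (φ₀ y) (Φ x z)

/-- `G ∘ F = id`, where the composite of `(φ, Φ)` and `(ψ, Ψ)` is the chain map `ψ ∘ φ` with the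
chain homotopy `(x, y) ↦ ψ₁ (Φ(x, y)) + Ψ(φ₀ x, φ₀ y)`, and the identity has zero homotopy. -/
structure Hom.IsLeftInverse {L : LieTwoOps L₀ L₁} {L' : LieTwoOps L₀' L₁'}
    (G : Hom L' L) (F : Hom L L') : Prop where
  φ₀_comp : ∀ x, G.φ₀ (F.φ₀ x) = x
  φ₁_comp : ∀ f, G.φ₁ (F.φ₁ f) = f
  Φ_comp : ∀ x y, G.φ₁ (F.Φ x y) + G.Φ (F.φ₀ x) (F.φ₀ y) = 0

/-- Two Lie 2-algebras are isomorphic if there are mutually inverse morphisms between them. -/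
def Isomorphic (L : LieTwoOps L₀ L₁) (L' : LieTwoOps L₀' L₁') : Prop :=
  ∃ (F : Hom L L') (G : Hom L' L), G.IsLeftInverse F ∧ F.IsLeftInverse G

end LieTwoOps

end LieTwo

section Hamiltonian

variable {E : Type*} [NormedAddCommGroup E] [NormedSpace ℝ E] [FiniteDimensional ℝ E]
  {M : Type*} [TopologicalSpace M] [ChartedSpace E M] [IsManifold 𝓘(ℝ, E) ∞ M]
  (Ω : ThreeForm E M)

/-- `v` is a Hamiltonian vector field of the 1-form `α`: `dα = -ι_v Ω`. -/
def IsHamiltonianField (α : OneForm E M) (v : VField E M) : Prop :=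
  ∀ X Y, OneForm.extDeriv α X Y = -Ω.ev v X Y

/-- The space `Ω¹_Ham(M)` of Hamiltonian 1-forms. -/
def HamForm : Submodule ℝ (OneForm E M) where
  carrier := {α | ∃ v, IsHamiltonianField Ω α v}
  add_mem' := by
    rintro α β ⟨v, hv⟩ ⟨w, hw⟩
    refine ⟨v + w, fun X Y => ?_⟩
    have h1 := hv X Y
    have h2 := hw X Y
    simp only [OneForm.extDeriv, OneForm.ev_add_left, act_add, ThreeForm.ev_add1] at h1 h2 ⊢
    linear_combination h1 + h2
  zero_mem' := by
    refine ⟨0, fun X Y => ?_⟩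
    have h := ThreeForm.ev_smul1 Ω 0 X Y 0
    have h0 : OneForm.ev (0 : OneForm E M) = 0 := rfl
    simp only [zero_smul] at h
    have hX := act_smul X 0 0
    have hY := act_smul Y 0 0
    simp only [zero_smul] at hX hY
    simp [OneForm.extDeriv, h, h0, hX, hY]
  smul_mem' := by
    rintro c α ⟨v, hv⟩
    refine ⟨c • v, fun X Y => ?_⟩
    have h1 := hv X Y
    simp only [OneForm.extDeriv, OneForm.ev_smul_left, act_smul, ThreeForm.ev_smul1] at h1 ⊢
    rw [← smul_sub, ← smul_sub, h1, smul_neg]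

variable {Ω}

theorem ThreeForm.IsNondegenerate.unique [T2Space M] (hΩ : Ω.IsNondegenerate) {α : OneForm E M}
    {v w : VField E M} (hv : IsHamiltonianField Ω α v) (hw : IsHamiltonianField Ω α w) :
    v = w := by
  ext x
  rw [← sub_eq_zero]
  refine hΩ x _ fun a b => ?_
  obtain ⟨X, rfl⟩ := exists_section (E := E) (F := E)
    (V := (TangentSpace 𝓘(ℝ, E) : M → Type _)) x a
  obtain ⟨Y, rfl⟩ := exists_section (E := E) (F := E)
    (V := (TangentSpace 𝓘(ℝ, E) : M → Type _)) x b
  have h := neg_injective ((hv X Y).symm.trans (hw X Y))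
  have h' := congrArg (fun g : Fn E M => g x) h
  simp only [ThreeForm.ev_apply] at h'
  rw [(Ω.toFun x).map_vecCons_sub, h', sub_self]

/-- The Hamiltonian vector field `v_α` of a Hamiltonian 1-form. -/
def hamField (α : HamForm Ω) : VField E M := α.2.choose

theorem hamField_spec (α : HamForm Ω) : IsHamiltonianField Ω α.1 (hamField α) := α.2.choose_spec

variable [T2Space M]

theorem hamField_add (hΩ : Ω.IsNondegenerate) (α β : HamForm Ω) :
    hamField (α + β) = hamField α + hamField β := by
  refine hΩ.unique (hamField_spec (α + β)) fun X Y => ?_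
  have h1 := hamField_spec α X Y
  have h2 := hamField_spec β X Y
  simp only [OneForm.extDeriv, Submodule.coe_add, OneForm.ev_add_left, act_add,
    ThreeForm.ev_add1] at h1 h2 ⊢
  linear_combination h1 + h2

theorem hamField_smul (hΩ : Ω.IsNondegenerate) (c : ℝ) (α : HamForm Ω) :
    hamField (c • α) = c • hamField α := by
  refine hΩ.unique (hamField_spec (c • α)) fun X Y => ?_
  have h1 := hamField_spec α X Y
  simp only [OneForm.extDeriv, Submodule.coe_smul, OneForm.ev_smul_left, act_smul,
    ThreeForm.ev_smul1] at h1 ⊢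
  rw [← smul_sub, ← smul_sub, h1, smul_neg]

/-- Exact 1-forms are Hamiltonian, with zero Hamiltonian vector field. -/
theorem isHamiltonianField_deRham (f : Fn E M) : IsHamiltonianField Ω (deRham E M f) 0 := by
  intro X Y
  have h := ThreeForm.ev_smul1 Ω 0 X Y 0
  simp only [zero_smul] at h
  simp [OneForm.extDeriv, OneForm.ev_deRham, act_lie, h]

/-- The bracket `{α, β} = ι_{v_β} ι_{v_α} Ω` has Hamiltonian vector field `[v_α, v_β]`. -/
theorem isHamiltonianField_contract (hΩ : Ω.IsClosed) {α β : OneForm E M} {a b : VField E M}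
    (ha : IsHamiltonianField Ω α a) (hb : IsHamiltonianField Ω β b) :
    IsHamiltonianField Ω (Ω.contract a b) (lie a b) := by
  intro X Y
  simp only [OneForm.extDeriv, ThreeForm.contract_ev]
  exact hΩ.extDeriv_contract (evLin α) (evLin β) a b ha hb X Y

/-- The Lie 2-algebra `L_∞(M, Ω)` of a 2-plectic manifold: `d : C^∞(M) → Ω¹_Ham(M)`, with the bracket
`{α, β} = ι_{v_β} ι_{v_α} Ω` in degree 0, the zero bracket in degree 1, and the Jacobiator
`J(α, β, γ) = ι_{v_α} ι_{v_β} ι_{v_γ} Ω = Ω(v_γ, v_β, v_α)`. -/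
def hamiltonianLieTwo (hΩ : Ω.IsTwoPlectic) : LieTwoOps (HamForm Ω) (Fn E M) where
  d := (deRham E M).codRestrict (HamForm Ω) fun f => ⟨0, isHamiltonianField_deRham f⟩
  br := LinearMap.mk₂ ℝ
    (fun α β => ⟨Ω.contract (hamField α) (hamField β), _,
      isHamiltonianField_contract hΩ.closed (hamField_spec α) (hamField_spec β)⟩)
    (fun α α' β => Subtype.ext (OneForm.ext_ev fun X => by
      simp [OneForm.ev_add_left, hamField_add hΩ.nondegenerate, ThreeForm.ev_add1]))
    (fun c α β => Subtype.ext (OneForm.ext_ev fun X => by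
      simp [OneForm.ev_smul_left, hamField_smul hΩ.nondegenerate, ThreeForm.ev_smul1]))
    (fun α β β' => Subtype.ext (OneForm.ext_ev fun X => by
      simp [OneForm.ev_add_left, hamField_add hΩ.nondegenerate, ThreeForm.ev_add2]))
    (fun c α β => Subtype.ext (OneForm.ext_ev fun X => by
      simp [OneForm.ev_smul_left, hamField_smul hΩ.nondegenerate, ThreeForm.ev_smul2]))
  br₁ := 0
  J := mkTri (fun α β γ => Ω.ev (hamField γ) (hamField β) (hamField α))
    (by simp [hamField_add hΩ.nondegenerate, ThreeForm.ev_add3])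
    (by simp [hamField_smul hΩ.nondegenerate, ThreeForm.ev_smul3])
    (by simp [hamField_add hΩ.nondegenerate, ThreeForm.ev_add2])
    (by simp [hamField_smul hΩ.nondegenerate, ThreeForm.ev_smul2])
    (by simp [hamField_add hΩ.nondegenerate, ThreeForm.ev_add1])
    (by simp [hamField_smul hΩ.nondegenerate, ThreeForm.ev_smul1])

end Hamiltonian


section Courant

variable (E : Type*) [NormedAddCommGroup E] [NormedSpace ℝ E] [FiniteDimensional ℝ E]
  {M : Type*} [TopologicalSpace M] [ChartedSpace E M] [IsManifold 𝓘(ℝ, E) ∞ M]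
  (F : Type*) [NormedAddCommGroup F] [NormedSpace ℝ F] [FiniteDimensional ℝ F]
  (V : M → Type*) [TopologicalSpace (Bundle.TotalSpace F V)] [∀ x, TopologicalSpace (V x)]
  [∀ x, AddCommGroup (V x)] [∀ x, Module ℝ (V x)] [FiberBundle F V] [VectorBundle ℝ F V]

/-- The data of a vector bundle `V → M` with a smooth nondegenerate symmetric bilinear form, a smooth
bundle map `ρ : V → TM` and a bilinear bracket on the space `Γ(V)` of smooth sections. -/
structure PreCourant where
  /-- The bilinear form on the fibres. -/
  form : ∀ x : M, LinearMap.BilinForm ℝ (V x)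
  form_smooth : ∀ e₁ e₂ : Cₛ^∞⟮𝓘(ℝ, E); F, V⟯,
    ContMDiff 𝓘(ℝ, E) 𝓘(ℝ, ℝ) ∞ (fun x => form x (e₁ x) (e₂ x))
  form_symm : ∀ (x : M) (a b : V x), form x a b = form x b a
  form_nondegenerate : ∀ x : M, (form x).Nondegenerate
  /-- The anchor. -/
  anchor : ∀ x : M, V x →ₗ[ℝ] TangentSpace 𝓘(ℝ, E) x
  anchor_smooth : ∀ e : Cₛ^∞⟮𝓘(ℝ, E); F, V⟯,
    ContMDiff 𝓘(ℝ, E) (𝓘(ℝ, E).prod 𝓘(ℝ, E)) ∞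
      (fun x => (⟨x, anchor x (e x)⟩ : TangentBundle 𝓘(ℝ, E) M))
  /-- The bracket of sections. -/
  bracket : Cₛ^∞⟮𝓘(ℝ, E); F, V⟯ →ₗ[ℝ] Cₛ^∞⟮𝓘(ℝ, E); F, V⟯ →ₗ[ℝ] Cₛ^∞⟮𝓘(ℝ, E); F, V⟯

namespace PreCourant

variable {E F V} (C : PreCourant E F V)

/-- The pairing `⟨e₁, e₂⟩` of sections. -/
def pair : Cₛ^∞⟮𝓘(ℝ, E); F, V⟯ →ₗ[ℝ] Cₛ^∞⟮𝓘(ℝ, E); F, V⟯ →ₗ[ℝ] Fn E M :=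
  LinearMap.mk₂ ℝ (fun e₁ e₂ => ⟨fun x => C.form x (e₁ x) (e₂ x), C.form_smooth e₁ e₂⟩)
    (fun a b c => by ext x; simp; rfl) (fun r a b => by ext x; simp; rfl)
    (fun a b c => by ext x; simp; rfl) (fun r a b => by ext x; simp; rfl)

@[simp] theorem pair_apply (e₁ e₂ : Cₛ^∞⟮𝓘(ℝ, E); F, V⟯) (x : M) :
    C.pair e₁ e₂ x = C.form x (e₁ x) (e₂ x) := rfl

/-- The vector field `ρ(e)`. -/
def rho : Cₛ^∞⟮𝓘(ℝ, E); F, V⟯ →ₗ[ℝ] VField E M where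
  toFun e := ⟨fun x => C.anchor x (e x), C.anchor_smooth e⟩
  map_add' a b := by ext x; simp
  map_smul' c a := by ext x; simp

@[simp] theorem rho_apply (e : Cₛ^∞⟮𝓘(ℝ, E); F, V⟯) (x : M) : C.rho e x = C.anchor x (e x) := rfl

/-- The dual map `ρ^* : T_x^* M → V_x` of the anchor, where `V_x` is identified with its dual via the
bilinear form: `⟨ρ^* a, c⟩ = a(ρ c)`. -/
def coanchor (x : M) : (TangentSpace 𝓘(ℝ, E) x →L[ℝ] ℝ) →ₗ[ℝ] V x :=
  have : FiniteDimensional ℝ (V x) := VectorBundle.finiteDimensional ℝ F V x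
  ((C.form x).toDual (C.form_nondegenerate x)).symm.toLinearMap ∘ₗ
    (C.anchor x).dualMap ∘ₗ ContinuousLinearMap.coeLM ℝ

theorem form_coanchor (x : M) (a : TangentSpace 𝓘(ℝ, E) x →L[ℝ] ℝ) (c : V x) :
    C.form x (C.coanchor x a) c = a (C.anchor x c) := by
  have : FiniteDimensional ℝ (V x) := VectorBundle.finiteDimensional ℝ F V x
  exact LinearMap.BilinForm.apply_toDual_symm_apply (hB := C.form_nondegenerate x) _ _

end PreCourant

/-- A Courant algebroid over `M` on the vector bundle `V`. -/
structure CourantAlgebroid extends PreCourant E F V where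
  /-- The operator `D = ρ^* d`, that is, `⟨D f, e⟩ = ρ(e)(f)`. -/
  D : Fn E M →ₗ[ℝ] Cₛ^∞⟮𝓘(ℝ, E); F, V⟯
  D_eq : ∀ f x, D f x = toPreCourant.coanchor x (diff E f x)
  skew : ∀ e₁ e₂, bracket e₁ e₂ = -bracket e₂ e₁
  jacobi : ∀ e₁ e₂ e₃,
    bracket e₁ (bracket e₂ e₃) - bracket (bracket e₁ e₂) e₃ - bracket e₂ (bracket e₁ e₃)
      = -D ((1 / 6 : ℝ) • (toPreCourant.pair (bracket e₁ e₂) e₃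
          + toPreCourant.pair (bracket e₃ e₁) e₂ + toPreCourant.pair (bracket e₂ e₃) e₁))
  rho_bracket : ∀ e₁ e₂,
    toPreCourant.rho (bracket e₁ e₂) = lie (toPreCourant.rho e₁) (toPreCourant.rho e₂)
  leibniz : ∀ e₁ e₂ (f : Fn E M),
    bracket e₁ (fsmul f e₂) = fsmul f (bracket e₁ e₂) + fsmul (act (toPreCourant.rho e₁) f) e₂
      - (1 / 2 : ℝ) • fsmul (toPreCourant.pair e₁ e₂) (D f)
  pair_D_D : ∀ f g, toPreCourant.pair (D f) (D g) = 0
  invariance : ∀ e₁ e₂ e₃,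
    act (toPreCourant.rho e₁) (toPreCourant.pair e₂ e₃)
      = toPreCourant.pair (bracket e₁ e₂ + (1 / 2 : ℝ) • D (toPreCourant.pair e₁ e₂)) e₃
        + toPreCourant.pair e₂ (bracket e₁ e₃ + (1 / 2 : ℝ) • D (toPreCourant.pair e₁ e₃))

namespace CourantAlgebroid

variable {E F V} (C : CourantAlgebroid E F V)

/-- A Courant algebroid is exact if `0 → T^*M → V → TM → 0` is an exact sequence of vector
bundles. -/
structure IsExact : Prop where
  injective : ∀ x, Function.Injective (C.coanchor x)
  exact : ∀ x, Function.Exact (C.coanchor x) (C.anchor x)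
  surjective : ∀ x, Function.Surjective (C.anchor x)

/-- A splitting of a Courant algebroid: an isotropic smooth splitting `s : TM → V` of the anchor. -/
structure Splitting where
  /-- The bundle map. -/
  toFun : ∀ x : M, TangentSpace 𝓘(ℝ, E) x →ₗ[ℝ] V x
  smooth : ∀ X : VField E M, ContMDiff 𝓘(ℝ, E) (𝓘(ℝ, E).prod 𝓘(ℝ, F)) ∞
    (fun x => (⟨x, toFun x (X x)⟩ : Bundle.TotalSpace F V))
  anchor_toFun : ∀ x v, C.anchor x (toFun x v) = v
  isotropic : ∀ x v w, C.form x (toFun x v) (toFun x w) = 0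

/-- The Dorfman bracket `⟦e₁, e₂⟧ = [e₁, e₂] + ½ D⟨e₁, e₂⟩`. -/
def dorfman : Cₛ^∞⟮𝓘(ℝ, E); F, V⟯ →ₗ[ℝ] Cₛ^∞⟮𝓘(ℝ, E); F, V⟯ →ₗ[ℝ] Cₛ^∞⟮𝓘(ℝ, E); F, V⟯ :=
  C.bracket + (1 / 2 : ℝ) • C.pair.compr₂ C.D

theorem dorfman_apply (e₁ e₂ : Cₛ^∞⟮𝓘(ℝ, E); F, V⟯) :
    C.dorfman e₁ e₂ = C.bracket e₁ e₂ + (1 / 2 : ℝ) • C.D (C.pair e₁ e₂) := rfl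

variable {C} in
/-- The section `s(X)`. -/
def Splitting.lift (s : C.Splitting) : VField E M →ₗ[ℝ] Cₛ^∞⟮𝓘(ℝ, E); F, V⟯ where
  toFun X := ⟨fun x => s.toFun x (X x), s.smooth X⟩
  map_add' a b := by ext x; simp
  map_smul' c a := by ext x; simp

variable {C} in
/-- The curvature 3-form of the splitting is `-Ω`: `⟨[s(X), s(Y)], s(Z)⟩ = -Ω(X, Y, Z)`. -/
def Splitting.HasCurvatureNeg (s : C.Splitting) (Ω : ThreeForm E M) : Prop :=
  ∀ X Y Z, C.pair (C.bracket (s.lift X) (s.lift Y)) (s.lift Z) = -Ω.ev X Y Z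

variable {C} in
/-- The space `Γ(V)^s` of sections `e` that preserve the splitting:
`⟦e, s(X)⟧ = s([ρ(e), X])` for all vector fields `X`. -/
def Splitting.preserving (s : C.Splitting) : Submodule ℝ Cₛ^∞⟮𝓘(ℝ, E); F, V⟯ where
  carrier := {e | ∀ X, C.dorfman e (s.lift X) = s.lift (lie (C.rho e) X)}
  add_mem' ha hb X := by
    rw [map_add, map_add, LinearMap.add_apply, ha X, hb X, lie_add_left, map_add]
  zero_mem' X := by
    have h := lie_smul_left 0 (0 : VField E M) X
    simp only [zero_smul] at h
    simp [h]
  smul_mem' c a ha X := by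
    rw [map_smul, map_smul, LinearMap.smul_apply, ha X, lie_smul_left, map_smul]

theorem pair_D (f : Fn E M) (e : Cₛ^∞⟮𝓘(ℝ, E); F, V⟯) : C.pair (C.D f) e = act (C.rho e) f := by
  ext x
  rw [C.pair_apply, C.D_eq, C.form_coanchor]
  rfl

theorem pair_symm (e e' : Cₛ^∞⟮𝓘(ℝ, E); F, V⟯) : C.pair e e' = C.pair e' e := by
  ext x
  exact C.form_symm x _ _

theorem dorfman_invariance (e₁ e₂ e₃ : Cₛ^∞⟮𝓘(ℝ, E); F, V⟯) :
    act (C.rho e₁) (C.pair e₂ e₃) = C.pair (C.dorfman e₁ e₂) e₃ + C.pair e₂ (C.dorfman e₁ e₃) :=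
  C.invariance e₁ e₂ e₃

theorem dorfman_add_swap (e₁ e₂ : Cₛ^∞⟮𝓘(ℝ, E); F, V⟯) :
    C.dorfman e₁ e₂ + C.dorfman e₂ e₁ = C.D (C.pair e₁ e₂) := by
  rw [dorfman_apply, dorfman_apply, C.pair_symm e₂ e₁, C.skew e₂ e₁]
  module

variable {C}

theorem pair_ker (hC : C.IsExact) {e e' : Cₛ^∞⟮𝓘(ℝ, E); F, V⟯} (h : C.rho e = 0)
    (h' : C.rho e' = 0) : C.pair e e' = 0 := by
  ext x
  obtain ⟨a, ha⟩ := (hC.exact x (e x)).1 (congrArg (fun X : VField E M => X x) h)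
  have h2 : C.anchor x (e' x) = 0 := congrArg (fun X : VField E M => X x) h'
  rw [C.pair_apply, ← ha, C.form_coanchor, h2]
  simp

theorem rho_D (hC : C.IsExact) (f : Fn E M) : C.rho (C.D f) = 0 := by
  ext x
  rw [C.rho_apply, C.D_eq]
  exact (hC.exact x _).2 ⟨_, rfl⟩

theorem rho_dorfman (hC : C.IsExact) (e₁ e₂ : Cₛ^∞⟮𝓘(ℝ, E); F, V⟯) :
    C.rho (C.dorfman e₁ e₂) = lie (C.rho e₁) (C.rho e₂) := by
  rw [dorfman_apply, map_add, map_smul, rho_D hC, smul_zero, add_zero, C.rho_bracket]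

namespace Splitting

variable (s : C.Splitting)

theorem rho_lift (X : VField E M) : C.rho (s.lift X) = X := by
  ext x
  exact s.anchor_toFun x _

theorem pair_lift_lift (X Y : VField E M) : C.pair (s.lift X) (s.lift Y) = 0 := by
  ext x
  exact s.isotropic x _ _

theorem dorfman_lift_lift (X Y : VField E M) :
    C.dorfman (s.lift X) (s.lift Y) = C.bracket (s.lift X) (s.lift Y) := by
  rw [dorfman_apply, s.pair_lift_lift]; simp

/-- A section of the kernel of the anchor is determined by its pairings with the sections `s(X)`. -/
theorem eq_of_pair_lift [T2Space M] (hC : C.IsExact) {e e' : Cₛ^∞⟮𝓘(ℝ, E); F, V⟯}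
    (h : C.rho e = C.rho e') (h' : ∀ X, C.pair e (s.lift X) = C.pair e' (s.lift X)) : e = e' := by
  rw [← sub_eq_zero]
  ext x
  have hx : C.anchor x ((e - e') x) = 0 := by
    have := congrArg (fun X : VField E M => X x) (sub_eq_zero.2 h)
    rw [← map_sub] at this
    exact this
  obtain ⟨a, ha⟩ := (hC.exact x _).1 hx
  have : a = 0 := by
    ext v
    obtain ⟨X, rfl⟩ := exists_section (E := E) (F := E)
      (V := (TangentSpace 𝓘(ℝ, E) : M → Type _)) x v
    have h1 := congrArg (fun f : Fn E M => f x) (sub_eq_zero.2 (h' X))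
    rw [← LinearMap.sub_apply, ← map_sub] at h1
    simp only [C.pair_apply] at h1
    rw [← ha, C.form_coanchor] at h1
    have h2 := s.anchor_toFun x (X x)
    exact (congrArg a h2).symm.trans h1
  rw [← ha, this, map_zero]
  rfl

variable {s} {Ω : ThreeForm E M}

theorem pair_bracket_lift (hC : C.IsExact) (hs : s.HasCurvatureNeg Ω)
    (e : Cₛ^∞⟮𝓘(ℝ, E); F, V⟯) (X Y : VField E M) :
    C.pair e (C.bracket (s.lift X) (s.lift Y))
      = C.pair e (s.lift (lie X Y)) - Ω.ev X Y (C.rho e) := by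
  have h1 : C.pair (e - s.lift (C.rho e))
      (C.bracket (s.lift X) (s.lift Y) - s.lift (lie X Y)) = 0 := by
    refine pair_ker hC ?_ ?_
    · rw [map_sub, s.rho_lift, sub_self]
    · rw [map_sub, C.rho_bracket, s.rho_lift, s.rho_lift, s.rho_lift, sub_self]
  have h2 := hs X Y (C.rho e)
  rw [C.pair_symm] at h2
  simp only [map_sub, LinearMap.sub_apply, s.pair_lift_lift, h2] at h1
  linear_combination h1

theorem pair_dorfman_lift (hC : C.IsExact) (hs : s.HasCurvatureNeg Ω)
    (e : Cₛ^∞⟮𝓘(ℝ, E); F, V⟯) (X Y : VField E M) :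
    C.pair (C.dorfman e (s.lift X)) (s.lift Y)
      = -(act X (C.pair e (s.lift Y)) - act Y (C.pair e (s.lift X)) - C.pair e (s.lift (lie X Y)))
        - Ω.ev (C.rho e) X Y := by
  have h1 := C.dorfman_add_swap e (s.lift X)
  have h2 := congrArg (fun t => C.pair t (s.lift Y)) h1
  have h3 := C.dorfman_invariance (s.lift X) e (s.lift Y)
  simp only [map_add, LinearMap.add_apply, C.pair_D] at h2
  rw [s.dorfman_lift_lift, pair_bracket_lift hC hs] at h3
  simp only [s.rho_lift] at h2 h3
  have h4 := Ω.ev_swap12 (C.rho e) X Y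
  have h5 := Ω.ev_swap23 X (C.rho e) Y
  linear_combination h2 + h3 + h4 - h5

/-- A section preserves the splitting iff `dα = -ι_v Ω`, where `v = ρ(e)` and `α = ⟨e, s(·)⟩`. -/
theorem mem_preserving_iff [T2Space M] (hC : C.IsExact) (hs : s.HasCurvatureNeg Ω)
    (e : Cₛ^∞⟮𝓘(ℝ, E); F, V⟯) :
    e ∈ s.preserving ↔ ∀ X Y,
      act X (C.pair e (s.lift Y)) - act Y (C.pair e (s.lift X)) - C.pair e (s.lift (lie X Y))
        = -Ω.ev (C.rho e) X Y := by
  constructor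
  · intro h X Y
    have h1 := pair_dorfman_lift hC hs e X Y
    rw [h X, s.pair_lift_lift] at h1
    linear_combination h1
  · intro h X
    refine s.eq_of_pair_lift hC ?_ fun Y => ?_
    · rw [rho_dorfman hC, s.rho_lift, s.rho_lift]
    · rw [pair_dorfman_lift hC hs, h X Y, s.pair_lift_lift]
      ring

theorem D_mem_preserving [T2Space M] (hC : C.IsExact) (hs : s.HasCurvatureNeg Ω) (f : Fn E M) :
    C.D f ∈ s.preserving := by
  rw [mem_preserving_iff hC hs]
  intro X Y
  have h := ThreeForm.ev_smul1 Ω 0 X Y 0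
  simp only [zero_smul] at h
  simp only [C.pair_D, s.rho_lift, rho_D hC, act_lie, h]
  simp

theorem bracket_mem_preserving [T2Space M] (hΩ : Ω.IsClosed) (hC : C.IsExact)
    (hs : s.HasCurvatureNeg Ω) {e₁ e₂ : Cₛ^∞⟮𝓘(ℝ, E); F, V⟯} (h₁ : e₁ ∈ s.preserving)
    (h₂ : e₂ ∈ s.preserving) : C.bracket e₁ e₂ ∈ s.preserving := by
  rw [mem_preserving_iff hC hs]
  have key : ∀ X, C.pair (C.bracket e₁ e₂) (s.lift X) = act (C.rho e₁) (C.pair e₂ (s.lift X))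
      - C.pair e₂ (s.lift (lie (C.rho e₁) X)) - (1 / 2 : ℝ) • act X (C.pair e₁ e₂) := by
    intro X
    have h := C.dorfman_invariance e₁ e₂ (s.lift X)
    rw [h₁ X, dorfman_apply, map_add, LinearMap.add_apply, map_smul, LinearMap.smul_apply, C.pair_D,
      s.rho_lift] at h
    rw [h]
    abel
  have h1' := (mem_preserving_iff hC hs e₁).1 h₁
  have h2' := (mem_preserving_iff hC hs e₂).1 h₂
  intro X Y
  have L := hΩ.lie_eq (C.pair e₁ ∘ₗ s.lift) (C.rho e₁) h1' (C.rho e₂) X Y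
  have a1 := congrArg (act (C.rho e₁)) (h2' X Y)
  have a2 := h2' (lie (C.rho e₁) X) Y
  have a3 := h2' X (lie (C.rho e₁) Y)
  have j := congrArg (fun Z => C.pair e₂ (s.lift Z)) (lie_jacobi (C.rho e₁) X Y)
  simp only [map_add] at j
  simp only [key, act_sub, act_smul, act_lie, act_neg, C.rho_bracket] at a1 a2 a3 ⊢
  rw [smul_sub]
  linear_combination a1 - a2 - a3 - L + j

end Splitting

variable (C) in
/-- The operations of the Lie 2-algebra `L_∞(C)`: `D : C^∞(M) → Γ(C)`, with the bracket of the Courant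
algebroid in degree 0, the bracket `[e, f] = ½ ⟨e, D f⟩` in degree 1, and the Jacobiator
`J(e₁, e₂, e₃) = -⅙ (⟨[e₁, e₂], e₃⟩ + ⟨[e₃, e₁], e₂⟩ + ⟨[e₂, e₃], e₁⟩)`. -/
def lieTwo : LieTwoOps Cₛ^∞⟮𝓘(ℝ, E); F, V⟯ (Fn E M) where
  d := C.D
  br := C.bracket
  br₁ := LinearMap.mk₂ ℝ (fun e f => (1 / 2 : ℝ) • C.pair e (C.D f))
    (fun a b c => by simp only [map_add, LinearMap.add_apply]; module)
    (fun r a b => by simp only [map_smul, LinearMap.smul_apply]; module)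
    (fun a b c => by simp only [map_add]; module)
    (fun r a b => by simp only [map_smul]; module)
  J := mkTri
    (fun e₁ e₂ e₃ => -((1 / 6 : ℝ) • (C.pair (C.bracket e₁ e₂) e₃ + C.pair (C.bracket e₃ e₁) e₂
      + C.pair (C.bracket e₂ e₃) e₁)))
    (fun a b c d => by simp only [map_add, LinearMap.add_apply]; module)
    (fun a b c d => by simp only [map_smul, LinearMap.smul_apply]; module)
    (fun a b c d => by simp only [map_add, LinearMap.add_apply]; module)
    (fun a b c d => by simp only [map_smul, LinearMap.smul_apply]; module)
    (fun a b c d => by simp only [map_add, LinearMap.add_apply]; module)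
    (fun a b c d => by simp only [map_smul, LinearMap.smul_apply]; module)

/-- The Lie 2-algebra `L_∞(C)^s`, the restriction of the operations of `L_∞(C)` to the subcomplex
`D : C^∞(M) → Γ(C)^s`. The hypotheses are only used to see that `Γ(C)^s` contains the image of `D` and
is closed under the bracket. -/
def preservingLieTwo [T2Space M] {s : C.Splitting} {Ω : ThreeForm E M} (hΩ : Ω.IsClosed)
    (hC : C.IsExact) (hs : s.HasCurvatureNeg Ω) : LieTwoOps s.preserving (Fn E M) :=
  C.lieTwo.restrict s.preserving (Splitting.D_mem_preserving hC hs)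
    fun _ h₁ _ h₂ => Splitting.bracket_mem_preserving hΩ hC hs h₁ h₂

end CourantAlgebroid

end Courant


namespace Twisted

section Twisted

variable (E : Type*) [NormedAddCommGroup E] [NormedSpace ℝ E] [FiniteDimensional ℝ E]
  (M : Type*) [TopologicalSpace M] [ChartedSpace E M] [IsManifold 𝓘(ℝ, E) ∞ M]

/-- The cotangent bundle. -/
abbrev Cotangent (x : M) : Type _ := TangentSpace 𝓘(ℝ, E) x →L[ℝ] Bundle.Trivial M ℝ x

/-- The bundle `TM ⊕ T^*M`. -/
abbrev TT : M → Type _ := (TangentSpace 𝓘(ℝ, E) : M → Type _) ×ᵇ (Cotangent E M)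

/-- Smooth sections `X + α` of `TM ⊕ T^*M`. -/
abbrev TTSec : Type _ := Cₛ^∞⟮𝓘(ℝ, E); E × (E →L[ℝ] ℝ), TT E M⟯

open Bundle

variable {E M}

/-- A section of `TM ⊕ T^*M` is smooth iff both components are. -/
theorem contMDiff_tt_iff (σ : ∀ x, TT E M x) :
    ContMDiff 𝓘(ℝ, E) (𝓘(ℝ, E).prod 𝓘(ℝ, E × (E →L[ℝ] ℝ))) ∞
      (fun x => (⟨x, σ x⟩ : TotalSpace (E × (E →L[ℝ] ℝ)) (TT E M))) ↔
    ContMDiff 𝓘(ℝ, E) (𝓘(ℝ, E).prod 𝓘(ℝ, E)) ∞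
      (fun x => (⟨x, (σ x).1⟩ : TangentBundle 𝓘(ℝ, E) M)) ∧
    ContMDiff 𝓘(ℝ, E) (𝓘(ℝ, E).prod 𝓘(ℝ, E →L[ℝ] ℝ)) ∞
      (fun x => (⟨x, (σ x).2⟩ : TotalSpace (E →L[ℝ] ℝ) (Cotangent E M))) := by
  unfold ContMDiff
  rw [← forall_and]
  refine forall_congr' fun x => ?_
  rw [Bundle.contMDiffAt_section, Bundle.contMDiffAt_section, Bundle.contMDiffAt_section]
  exact contMDiffAt_prod_module_iff _

theorem exists_section_eventuallyEq [T2Space M] {F : Type*} [NormedAddCommGroup F] [NormedSpace ℝ F]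
    {V : M → Type*}
    [TopologicalSpace (Bundle.TotalSpace F V)] [∀ x, TopologicalSpace (V x)]
    [∀ x, AddCommGroup (V x)] [∀ x, Module ℝ (V x)] [FiberBundle F V] [VectorBundle ℝ F V]
    [ContMDiffVectorBundle ∞ F V 𝓘(ℝ, E)] (x : M) (v : V x) :
    ∃ e : Cₛ^∞⟮𝓘(ℝ, E); F, V⟯, ∀ᶠ y in nhds x, e y = FiberBundle.extend F v y := by
  obtain ⟨s, hs, hsm⟩ := FiberBundle.exists_contMDiffOn_extend 𝓘(ℝ, E) F (k := ∞) v
  obtain ⟨u, hus, huo, hxu⟩ := mem_nhds_iff.1 hs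
  obtain ⟨ψ, hψ⟩ := ((SmoothBumpFunction.nhds_basis_tsupport (I := 𝓘(ℝ, E)) x).mem_iff).1
    (huo.mem_nhds hxu)
  refine ⟨⟨(ψ : M → ℝ) • FiberBundle.extend F v,
    ContMDiffOn.smul_section_of_tsupport ψ.contMDiff.contMDiffOn huo hψ.2 (hsm.mono hus)⟩, ?_⟩
  filter_upwards [ψ.eventuallyEq_one] with y hy
  simp [hy]

/-- A 1-form that is smooth on vector fields is a smooth section of the cotangent bundle. -/
theorem contMDiff_cotangent [T2Space M] (α : OneForm E M) :
    ContMDiff 𝓘(ℝ, E) (𝓘(ℝ, E).prod 𝓘(ℝ, E →L[ℝ] ℝ)) ∞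
      (fun x => (⟨x, α.1 x⟩ : TotalSpace (E →L[ℝ] ℝ) (Cotangent E M))) := by
  intro x₀
  rw [contMDiffAt_hom_bundle]
  refine ⟨contMDiffAt_id, ?_⟩
  let b := Module.finBasis ℝ E
  let c : Fin (Module.finrank ℝ E) → (E →L[ℝ] ℝ) := fun i =>
    LinearMap.toContinuousLinearMap (b.coord i)
  let t := trivializationAt E (TangentSpace 𝓘(ℝ, E) : M → Type _) x₀
  have hrep : ∀ L : E →L[ℝ] ℝ, L = ∑ i, L (b i) • c i := by
    intro L
    refine ContinuousLinearMap.coe_inj.1 (b.ext fun j => ?_)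
    simp [c, Finsupp.single_apply]
  choose X hX using fun i => exists_section_eventuallyEq (E := E) (F := E)
    (V := (TangentSpace 𝓘(ℝ, E) : M → Type _)) x₀ (t.symm x₀ (b i))
  have hs : ContMDiffAt 𝓘(ℝ, E) 𝓘(ℝ, E →L[ℝ] ℝ) ∞ (fun x => ∑ i, (OneForm.ev α (X i) x) • c i) x₀ :=
    ContMDiffAt.sum fun i _ => ((α.2 (X i)).contMDiffAt).smul contMDiffAt_const
  refine hs.congr_of_eventuallyEq ?_
  filter_upwards [Filter.eventually_all.2 hX,
    t.open_baseSet.mem_nhds (FiberBundle.mem_baseSet_trivializationAt' x₀)] with x hx hxt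
  rw [hrep (ContinuousLinearMap.inCoordinates E (TangentSpace 𝓘(ℝ, E)) ℝ (Bundle.Trivial M ℝ) x₀ x x₀ x (α.1 x))]
  refine Finset.sum_congr rfl fun i _ => ?_
  congr 1
  rw [OneForm.ev_apply, hx i]
  rw [ContinuousLinearMap.inCoordinates_eq hxt (by trivial)]
  simp only [FiberBundle.extend]
  have h := t.apply_mk_symm (FiberBundle.mem_baseSet_trivializationAt' x₀) (b i)
  simp [t] at h ⊢
  rw [h]

theorem contMDiff_cotangent_iff [T2Space M] (σ : ∀ x, Cotangent E M x) :
    ContMDiff 𝓘(ℝ, E) (𝓘(ℝ, E).prod 𝓘(ℝ, E →L[ℝ] ℝ)) ∞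
      (fun x => (⟨x, σ x⟩ : TotalSpace (E →L[ℝ] ℝ) (Cotangent E M))) ↔ 
    ∀ X : VField E M, ContMDiff 𝓘(ℝ, E) 𝓘(ℝ, ℝ) ∞ (fun x => σ x (X x)) := by
  refine ⟨fun h X => ?_, fun h => contMDiff_cotangent (⟨σ, h⟩ : OneForm E M)⟩
  have := ContMDiff.clm_bundle_apply h X.contMDiff
  intro x
  have h2 := this x
  rw [Bundle.contMDiffAt_section] at h2
  exact h2

variable [T2Space M]

/-- The Lie derivative of a 1-form, as an operation on sections. -/
def lieOp (X : VField E M) (α : OneForm E M) (x : M) (σ : ∀ y : M, TangentSpace 𝓘(ℝ, E) y) : ℝ :=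
  mvfderiv 𝓘(ℝ, E) (fun y => α.1 y (σ y)) x (X x) - α.1 x (VectorField.mlieBracket 𝓘(ℝ, E) X σ x)

theorem mdiff_ev (α : OneForm E M) {x : M} {σ : ∀ y : M, TangentSpace 𝓘(ℝ, E) y}
    (hσ : MDifferentiableAt 𝓘(ℝ, E) (𝓘(ℝ, E).prod 𝓘(ℝ, E)) (fun y => (⟨y, σ y⟩ : TangentBundle 𝓘(ℝ, E) M)) x) :
    MDifferentiableAt 𝓘(ℝ, E) 𝓘(ℝ, ℝ) (fun y => α.1 y (σ y)) x := by
  have h1 := (contMDiff_cotangent α).mdifferentiableAt (by simp) (x := x)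
  have := MDifferentiableAt.clm_bundle_apply h1 hσ
  rw [mdifferentiableAt_section] at this
  exact this

theorem lieOp_tensorial (X : VField E M) (α : OneForm E M) (x : M) :
    TensorialAt 𝓘(ℝ, E) E (lieOp X α x) x where
  smul {f σ} hf hσ := by
    have : CompleteSpace E := FiniteDimensional.complete ℝ E
    have h1 := mvfderiv_mul hf (mdiff_ev α hσ)
    have h2 := VectorField.mlieBracket_smul_right (V := X) hf hσ
    have h3 : (fun y => α.1 y ((f • σ) y)) = f * fun y => α.1 y (σ y) := by
      ext y; simp
    rw [lieOp, lieOp, h3, h1, h2]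
    simp
    ring
  add {σ σ'} hσ hσ' := by
    have : CompleteSpace E := FiniteDimensional.complete ℝ E
    have h1 := mvfderiv_add (mdiff_ev α hσ) (mdiff_ev α hσ')
    have h2 := VectorField.mlieBracket_add_right (V := X) hσ hσ'
    have h3 : (fun y => α.1 y ((σ + σ') y)) = (fun y => α.1 y (σ y)) + fun y => α.1 y (σ' y) := by
      ext y; simp
    rw [lieOp, lieOp, lieOp, h3, h1, h2]
    simp
    ring

/-- The Lie derivative of a 1-form: `(L_X α)(Y) = X(α(Y)) - α([X, Y])`. -/
def lieDeriv (X : VField E M) (α : OneForm E M) : OneForm E M :=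
  ⟨fun x => TensorialAt.mkHom _ x (lieOp_tensorial X α x), fun Y => by
    refine (act X (OneForm.ev α Y) - OneForm.ev α (lie X Y)).contMDiff.congr fun x => ?_
    exact TensorialAt.mkHom_apply (lieOp_tensorial X α x) Y.mdifferentiableAt⟩

theorem lieDeriv_ev (X Y : VField E M) (α : OneForm E M) :
    OneForm.ev (lieDeriv X α) Y = act X (OneForm.ev α Y) - OneForm.ev α (lie X Y) := by
  ext x
  exact TensorialAt.mkHom_apply (lieOp_tensorial X α x) Y.mdifferentiableAt

/-- The section `X + α`. -/
def mk (X : VField E M) (α : OneForm E M) : TTSec E M :=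
  ⟨fun x => (X x, α.1 x), (contMDiff_tt_iff _).2 ⟨X.contMDiff, contMDiff_cotangent α⟩⟩

variable (E M) in
/-- The vector field of a section `X + α`. -/
def vec : TTSec E M →ₗ[ℝ] VField E M where
  toFun e := ⟨fun x => (e x).1, ((contMDiff_tt_iff e).1 e.contMDiff).1⟩
  map_add' a b := by ext x; rfl
  map_smul' a b := by ext x; rfl

variable (E M) in
/-- The 1-form of a section `X + α`. -/
def frm : TTSec E M →ₗ[ℝ] OneForm E M where
  toFun e := ⟨fun x => (e x).2, (contMDiff_cotangent_iff _).1 ((contMDiff_tt_iff e).1 e.contMDiff).2⟩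
  map_add' _ _ := rfl
  map_smul' _ _ := rfl

@[simp] theorem vec_mk (X : VField E M) (α : OneForm E M) : vec E M (mk X α) = X := rfl
@[simp] theorem frm_mk (X : VField E M) (α : OneForm E M) : frm E M (mk X α) = α := rfl

theorem sec_ext {e e' : TTSec E M} (h : vec E M e = vec E M e')
    (h' : ∀ Y, OneForm.ev (frm E M e) Y = OneForm.ev (frm E M e') Y) : e = e' := by
  ext x
  · exact congrArg (fun X : VField E M => X x) h
  · have := OneForm.ext_ev h'
    exact congrArg (fun a : OneForm E M => a.1 x _) this

/-- The bilinear form `⟨v + a, w + b⟩ = a(w) + b(v)`. -/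
def ttForm (x : M) : LinearMap.BilinForm ℝ (TT E M x) :=
  LinearMap.mk₂ ℝ (fun a b => a.2 b.1 + b.2 a.1)
    (fun a b c => by simp; ring) (fun r a b => by simp; ring)
    (fun a b c => by simp; ring) (fun r a b => by simp; ring)

theorem ttForm_apply (x : M) (a b : TT E M x) : ttForm x a b = a.2 b.1 + b.2 a.1 := rfl

theorem ttForm_nondegenerate (x : M) : (ttForm (E := E) x).Nondegenerate := by
  have key : ∀ a : TT E M x, (∀ b, ttForm x a b = 0) → a = 0 := by
    intro a h
    have h2 : a.2 = 0 := by
      ext v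
      have := h (v, 0)
      simpa [ttForm_apply] using this
    have h1 : a.1 = 0 := by
      by_contra hne
      have hne' : (show E from a.1) ≠ (0 : E) := hne
      obtain ⟨f, hf⟩ := SeparatingDual.exists_ne_zero (R := ℝ) hne'
      have := h (0, f)
      simp [ttForm_apply, h2] at this
      exact hf this
    exact Prod.ext h1 h2
  refine ⟨key, fun a h => key a fun b => ?_⟩
  rw [ttForm_apply, add_comm]
  exact h b

/-- The twisted Courant bracket
`[X + α, Y + β] = [X, Y] + L_X β - L_Y α - ½ d(β(X) - α(Y)) - ι_Y ι_X Ω`. -/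
def ttBr (Ω : ThreeForm E M) (a b : TTSec E M) : TTSec E M :=
  mk (lie (vec E M a) (vec E M b))
    (lieDeriv (vec E M a) (frm E M b) - lieDeriv (vec E M b) (frm E M a)
      - (1 / 2 : ℝ) • deRham E M (OneForm.ev (frm E M b) (vec E M a) - OneForm.ev (frm E M a) (vec E M b))
      - Ω.contract (vec E M a) (vec E M b))

theorem ttBr_vec (Ω : ThreeForm E M) (a b : TTSec E M) :
    vec E M (ttBr Ω a b) = lie (vec E M a) (vec E M b) := rfl

theorem ttBr_frm (Ω : ThreeForm E M) (a b : TTSec E M) (Y : VField E M) :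
    OneForm.ev (frm E M (ttBr Ω a b)) Y =
      act (vec E M a) (OneForm.ev (frm E M b) Y) - OneForm.ev (frm E M b) (lie (vec E M a) Y)
      - (act (vec E M b) (OneForm.ev (frm E M a) Y) - OneForm.ev (frm E M a) (lie (vec E M b) Y))
      - (1 / 2 : ℝ) • (act Y (OneForm.ev (frm E M b) (vec E M a)) - act Y (OneForm.ev (frm E M a) (vec E M b)))
      - Ω.ev (vec E M a) (vec E M b) Y := by
  rw [← lieDeriv_ev, ← lieDeriv_ev, ← ThreeForm.contract_ev, ← act_sub]
  rfl

/-- The bundle `TM ⊕ T^*M` with the pairing `⟨·,·⟩`, the projection to `TM` and the twisted Courant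
bracket. -/
def ttPre (Ω : ThreeForm E M) : PreCourant E (E × (E →L[ℝ] ℝ)) (TT E M) where
  form := ttForm
  form_smooth a b := (OneForm.ev (frm E M a) (vec E M b) + OneForm.ev (frm E M b) (vec E M a)).contMDiff
  form_symm x a b := by rw [ttForm_apply, ttForm_apply, add_comm]
  form_nondegenerate := ttForm_nondegenerate
  anchor x := LinearMap.fst ℝ _ _
  anchor_smooth e := (vec E M e).contMDiff
  bracket := LinearMap.mk₂ ℝ (ttBr Ω)
    (fun a b c => by
      refine sec_ext ?_ fun Y => ?_
      · simp only [map_add, ttBr_vec, lie_add_left]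
      · simp only [map_add, ttBr_frm, OneForm.ev_add_left, OneForm.ev_add, act_add, act_add_left,
          lie_add_left, ThreeForm.ev_add1]
        module)
    (fun r a b => by
      refine sec_ext ?_ fun Y => ?_
      · simp only [map_smul, ttBr_vec, lie_smul_left]
      · simp only [map_smul, ttBr_frm, OneForm.ev_smul_left, OneForm.ev_smul, act_smul, act_smul_left,
          lie_smul_left, ThreeForm.ev_smul1]
        module)
    (fun a b c => by
      refine sec_ext ?_ fun Y => ?_
      · simp only [map_add, ttBr_vec, lie_add_right]
      · simp only [map_add, ttBr_frm, OneForm.ev_add_left, OneForm.ev_add, act_add, act_add_left,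
          lie_add_left, ThreeForm.ev_add2]
        module)
    (fun r a b => by
      refine sec_ext ?_ fun Y => ?_
      · simp only [map_smul, ttBr_vec, lie_smul_right]
      · simp only [map_smul, ttBr_frm, OneForm.ev_smul_left, OneForm.ev_smul, act_smul, act_smul_left,
          lie_smul_left, ThreeForm.ev_smul2]
        module)

variable (Ω : ThreeForm E M)

theorem ttPre_rho (a : TTSec E M) : (ttPre Ω).rho a = vec E M a := rfl
theorem ttPre_bracket (a b : TTSec E M) : (ttPre Ω).bracket a b = ttBr Ω a b := rfl
theorem ttPre_pair (a b : TTSec E M) : (ttPre Ω).pair a b =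
  OneForm.ev (frm E M a) (vec E M b) + OneForm.ev (frm E M b) (vec E M a) := rfl
theorem ttPre_coanchor (x : M) (a : TangentSpace 𝓘(ℝ, E) x →L[ℝ] ℝ) :
    (ttPre Ω).coanchor x a = ((0, a) : TT E M x) := by
  have h := (ttPre Ω).form_coanchor x a
  have h2 : ∀ c : TT E M x, (ttPre Ω).form x ((ttPre Ω).coanchor x a - ((0, a) : TT E M x)) c = 0 := by
    intro c
    rw [map_sub, LinearMap.sub_apply, h]
    change a c.1 - (a c.1 + c.2 0) = 0
    simp
  exact sub_eq_zero.1 (((ttPre Ω).form_nondegenerate x).1 _ h2)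

variable (E M) in
/-- The operator `f ↦ df`. -/
def ttD : Fn E M →ₗ[ℝ] TTSec E M where
  toFun f := mk 0 (deRham E M f)
  map_add' f g := by
    refine sec_ext (by simp) fun Y => ?_
    simp [OneForm.ev_add_left]
  map_smul' c f := by
    refine sec_ext (by simp) fun Y => ?_
    simp [OneForm.ev_smul_left]

theorem ttD_vec (f : Fn E M) : vec E M (ttD E M f) = 0 := rfl
theorem ttD_frm (f : Fn E M) (Y : VField E M) : OneForm.ev (frm E M (ttD E M f)) Y = act Y f := rfl

theorem vec_fsmul (f : Fn E M) (a : TTSec E M) : vec E M (fsmul f a) = fsmul f (vec E M a) := rfl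
theorem frm_fsmul (f : Fn E M) (a : TTSec E M) (Y : VField E M) :
    OneForm.ev (frm E M (fsmul f a)) Y = f * OneForm.ev (frm E M a) Y := rfl
theorem ev_fsmul (f : Fn E M) (α : OneForm E M) (Y : VField E M) :
    OneForm.ev α (fsmul f Y) = f * OneForm.ev α Y := by
  ext x; simp [fsmul]
theorem Om_fsmul1 (f : Fn E M) (X Y Z : VField E M) : Ω.ev (fsmul f X) Y Z = f * Ω.ev X Y Z := by
  ext x
  exact (Ω.toFun x).vecCons_smul _ _ _
theorem Om_fsmul2 (f : Fn E M) (X Y Z : VField E M) : Ω.ev X (fsmul f Y) Z = f * Ω.ev X Y Z := by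
  rw [Ω.ev_swap12, Om_fsmul1, Ω.ev_swap12 Y]; ring
theorem act_fsmul (f g : Fn E M) (X : VField E M) : act (fsmul f X) g = f * act X g := by
  ext x; simp [fsmul]
theorem lie_fsmul_left (f : Fn E M) (X Y : VField E M) :
    lie (fsmul f X) Y = fsmul f (lie X Y) - fsmul (act Y f) X := by
  rw [lie_skew, lie_fsmul_right, lie_skew Y X]
  ext x; simp [fsmul]; abel

theorem ev_sub (α : OneForm E M) (X Y : VField E M) :
    OneForm.ev α (X - Y) = OneForm.ev α X - OneForm.ev α Y := (evLin α).map_sub X Y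
theorem ev_neg (α : OneForm E M) (X : VField E M) :
    OneForm.ev α (-X) = -OneForm.ev α X := (evLin α).map_neg X
theorem ev_zero (α : OneForm E M) : OneForm.ev α 0 = 0 := (evLin α).map_zero
theorem ev_sub_left (α β : OneForm E M) (X : VField E M) :
    OneForm.ev (α - β) X = OneForm.ev α X - OneForm.ev β X := rfl
theorem ev_neg_left (α : OneForm E M) (X : VField E M) :
    OneForm.ev (-α) X = -OneForm.ev α X := rfl

theorem tt_leibniz (a b : TTSec E M) (f : Fn E M) :
    ttBr Ω a (fsmul f b) = fsmul f (ttBr Ω a b) + fsmul (act (vec E M a) f) b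
      - (1 / 2 : ℝ) • fsmul ((ttPre Ω).pair a b) (ttD E M f) := by
  refine sec_ext ?_ fun Y => ?_
  · simp only [map_sub, map_add, map_smul, ttBr_vec, vec_fsmul, ttD_vec, lie_fsmul_right]
    ext x; simp [fsmul]; abel
  · simp only [map_sub, map_add, map_smul, ev_sub_left, OneForm.ev_add_left, OneForm.ev_smul_left,
      ttBr_frm, vec_fsmul, frm_fsmul, ttD_frm, lie_fsmul_left, act_fsmul, ev_sub, ev_fsmul, Om_fsmul2,
      act_mul, ttPre_pair]
    ext x
    simp
    ring

theorem tt_skew (a b : TTSec E M) : ttBr Ω a b = - ttBr Ω b a := by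
  refine sec_ext ?_ fun Y => ?_
  · simp only [map_neg, ttBr_vec]; exact lie_skew _ _
  · simp only [map_neg, ev_neg_left, ttBr_frm]
    rw [Ω.ev_swap12]
    module

theorem tt_invariance (a b c : TTSec E M) :
    act (vec E M a) ((ttPre Ω).pair b c)
      = (ttPre Ω).pair (ttBr Ω a b + (1 / 2 : ℝ) • ttD E M ((ttPre Ω).pair a b)) c
        + (ttPre Ω).pair b (ttBr Ω a c + (1 / 2 : ℝ) • ttD E M ((ttPre Ω).pair a c)) := by
  simp only [ttPre_pair]
  simp only [map_add, map_smul, ttBr_vec, ttD_vec, OneForm.ev_add_left,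
    OneForm.ev_smul_left, ttBr_frm, ttD_frm, act_add, OneForm.ev_add]
  have := Ω.ev_swap23 (vec E M a) (vec E M b) (vec E M c)
  rw [lie_skew (vec E M c) (vec E M b), ev_neg, this]
  ext x
  simp
  ring

theorem tt_jacobi (hΩ : Ω.IsClosed) (a b c : TTSec E M) :
    ttBr Ω a (ttBr Ω b c) - ttBr Ω (ttBr Ω a b) c - ttBr Ω b (ttBr Ω a c)
      = - ttD E M ((1 / 6 : ℝ) • ((ttPre Ω).pair (ttBr Ω a b) c
          + (ttPre Ω).pair (ttBr Ω c a) b + (ttPre Ω).pair (ttBr Ω b c) a)) := by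
  refine sec_ext ?_ fun Y => ?_
  · simp only [map_sub, map_neg, ttBr_vec, ttD_vec]
    rw [lie_jacobi]; abel_nf
  · simp only [map_sub, map_neg, ttPre_pair, ev_sub_left, ev_neg_left, ttD_frm]
    simp only [ttBr_vec, ttBr_frm, act_sub, act_add, act_smul, act_lie]
    generalize vec E M a = A
    generalize vec E M b = B
    generalize vec E M c = C
    generalize frm E M a = α
    generalize frm E M b = β
    generalize frm E M c = γ
    have hcl := hΩ A B C Y
    simp only [ThreeForm.extDeriv] at hcl
    simp only [lie_skew B A, lie_skew C A, lie_skew C B, ev_neg, act_neg]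
    have ja := congrArg (OneForm.ev α) (lie_jacobi B C Y)
    have jb := congrArg (OneForm.ev β) (lie_jacobi A C Y)
    have jc := congrArg (OneForm.ev γ) (lie_jacobi A B Y)
    simp only [OneForm.ev_add] at ja jb jc
    have o1 := Ω.ev_swap12 (lie A C) B Y
    have o2 := Ω.ev_swap12 (lie B C) A Y
    have o3 := (Ω.ev_swap12 (lie A Y) B C).trans (congrArg _ (Ω.ev_swap23 B (lie A Y) C))
    have o4 := (Ω.ev_swap12 (lie B Y) A C).trans (congrArg _ (Ω.ev_swap23 A (lie B Y) C))
    have o5 := (Ω.ev_swap12 (lie C Y) A B).trans (congrArg _ (Ω.ev_swap23 A (lie C Y) B))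
    have p1 : Ω.ev B C A = Ω.ev A B C := by rw [Ω.ev_swap23, Ω.ev_swap12 B A]; simp
    have p2 : Ω.ev A C B = -Ω.ev A B C := Ω.ev_swap23 _ _ _
    have p3 : Ω.ev C A B = Ω.ev A B C := by rw [Ω.ev_swap12, Ω.ev_swap23 A C]; simp
    rw [o1, o2, o3, o4, o5] at hcl
    simp only [p1, p2, p3, act_neg]
    linear_combination (norm := module) jb - ja - jc - hcl

/-- The Courant algebroid `TM ⊕ T^*M` with the bracket twisted by a closed 3-form. -/
def ttCourant (hΩ : Ω.IsClosed) : CourantAlgebroid E (E × (E →L[ℝ] ℝ)) (TT E M) where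
  toPreCourant := ttPre Ω
  D := ttD E M
  D_eq f x := (ttPre_coanchor Ω x _).symm
  skew := tt_skew Ω
  jacobi := tt_jacobi Ω hΩ
  rho_bracket a b := rfl
  leibniz := tt_leibniz Ω
  pair_D_D f g := by
    rw [ttPre_pair, ttD_vec, ttD_vec, ev_zero, ev_zero, add_zero]
  invariance := tt_invariance Ω

/-- The splitting `v ↦ v + 0`. -/
def ttSplitting (hΩ : Ω.IsClosed) : (ttCourant Ω hΩ).Splitting where
  toFun x := LinearMap.inl ℝ _ _
  smooth X := (mk X 0).contMDiff
  anchor_toFun x v := rfl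
  isotropic x v w := by
    change (0 : TangentSpace 𝓘(ℝ, E) x →L[ℝ] ℝ) w + (0 : TangentSpace 𝓘(ℝ, E) x →L[ℝ] ℝ) v = 0
    simp

theorem exists_courant (hΩ : Ω.IsClosed) :
    ∃ (C : CourantAlgebroid E (E × (E →L[ℝ] ℝ)) (TT E M)) (s : C.Splitting),
      C.IsExact ∧ s.HasCurvatureNeg Ω := by
  refine ⟨ttCourant Ω hΩ, ttSplitting Ω hΩ, ⟨fun x a b h => ?_, fun x v => ?_, fun x v => ⟨(v, 0), rfl⟩⟩,
    fun X Y Z => ?_⟩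
  · have h' : (ttPre Ω).coanchor x a = (ttPre Ω).coanchor x b := h
    rw [ttPre_coanchor, ttPre_coanchor] at h'
    exact congrArg Prod.snd h'
  · constructor
    · intro h
      exact ⟨v.2, (ttPre_coanchor Ω x v.2).trans (Prod.ext (Eq.symm h) rfl)⟩
    · rintro ⟨a, rfl⟩
      exact congrArg Prod.fst (ttPre_coanchor Ω x a)
  · have hl : ∀ W, (ttSplitting Ω hΩ).lift W = mk W 0 := fun W => rfl
    have hz : ∀ W : VField E M, OneForm.ev (0 : OneForm E M) W = 0 := fun W => rfl
    have hb : (ttCourant Ω hΩ).bracket (mk X 0) (mk Y 0) = ttBr Ω (mk X 0) (mk Y 0) := rfl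
    have hp : ∀ a b, (ttCourant Ω hΩ).pair a b = (ttPre Ω).pair a b := fun a b => rfl
    have h0 : ∀ W : VField E M, act W (0 : Fn E M) = 0 := fun W => by simpa using act_smul W 0 0
    rw [hl, hl, hl, hb, hp, ttPre_pair, vec_mk, frm_mk, ttBr_frm]
    simp [hz, h0]

end Twisted

end Twisted

end TwoPlectic
end

/-! A splitting `s` of an exact Courant algebroid identifies a section `e` with the pair of its vector
field `v = ρ(e)` and its 1-form `α = ⟨e, s(·)⟩`, so that `e = s(v) + ρ^* α`. If the curvature of `s` is
`-Ω`, then `e` preserves the splitting exactly when `dα = -ι_v Ω`. As `Ω` is nondegenerate, `v` is then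
determined by `α`, and `e ↦ α` identifies `Γ(C)^s` with the space of Hamiltonian 1-forms
(`CourantAlgebroid.hamFormEquiv`). That `ρ^* α` is smooth is a local matter: near a point
`α = ∑ gᵢ dfᵢ`, hence `ρ^* α = ∑ gᵢ D fᵢ`.

In these terms the Courant bracket of `(X, α)` and `(Y, β)` has the 1-form
`ι_Y ι_X Ω + ½ d(β(X) - α(Y))` (`CourantAlgebroid.Splitting.ev_toForm_bracket`). The bracket of
Hamiltonian forms exceeds it by the exact form `dΦ(α, β)`, where `Φ(α, β) = ½ (α(v_β) - β(v_α))`; so `Φ`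
is the chain homotopy of an isomorphism that is the identity on `C^∞(M)`. The Jacobiator becomes `-Ω(X, Y, Z)` minus a quarter of the alternating sum of the `X(γ(Y))`
(`CourantAlgebroid.Splitting.lieTwo_J`).

The laws of both Lie 2-algebras and of the morphism then reduce to three facts: Hamiltonian vector
fields preserve `Ω`, `dα(X, Y) = -Ω(v_α, X, Y)`, and `dΩ = 0`. A morphism with invertible chain map is
an isomorphism (`LieTwoOps.Hom.isomorphic`). -/

namespace TwoPlectic

/-! ### Isomorphisms of Lie 2-algebras -/

namespace LieTwoOps

variable {L₀ L₁ L₀' L₁' : Type*} [AddCommGroup L₀] [Module ℝ L₀] [AddCommGroup L₁] [Module ℝ L₁]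
  [AddCommGroup L₀'] [Module ℝ L₀'] [AddCommGroup L₁'] [Module ℝ L₁']
  {L : LieTwoOps L₀ L₁} {L' : LieTwoOps L₀' L₁'}

/-- The inverse of a morphism whose underlying chain map has an inverse `(ψ₀, ψ₁)`: its chain
homotopy is `(x, y) ↦ -ψ₁ Φ(ψ₀ x, ψ₀ y)`. -/
def Hom.inverse (F : Hom L L') (ψ₀ : L₀' →ₗ[ℝ] L₀) (ψ₁ : L₁' →ₗ[ℝ] L₁)
    (h₀ : ∀ x, ψ₀ (F.φ₀ x) = x) (h₀' : ∀ x, F.φ₀ (ψ₀ x) = x)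
    (h₁ : ∀ f, ψ₁ (F.φ₁ f) = f) (h₁' : ∀ f, F.φ₁ (ψ₁ f) = f) : Hom L' L where
  φ₀ := ψ₀
  φ₁ := ψ₁
  Φ := -((F.Φ.compl₁₂ ψ₀ ψ₀).compr₂ ψ₁)
  comm f := by
    have h := congrArg ψ₀ (F.comm (ψ₁ f))
    rw [h₀, h₁'] at h
    exact h.symm
  skew x y := by
    have h := congrArg ψ₁ (F.skew (ψ₀ x) (ψ₀ y))
    rw [map_neg] at h
    simpa using congrArg Neg.neg h
  homotopy₀ x y := by
    have h := congrArg ψ₀ (F.homotopy₀ (ψ₀ x) (ψ₀ y))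
    have hc := congrArg ψ₀ (F.comm (ψ₁ (F.Φ (ψ₀ x) (ψ₀ y))))
    rw [h₀, h₁'] at hc
    simp only [map_sub, h₀, h₀'] at h
    simp only [LinearMap.neg_apply, LinearMap.compr₂_apply, LinearMap.compl₁₂_apply, map_neg]
    rw [hc, ← h]
    abel
  homotopy₁ x f := by
    have h := congrArg ψ₁ (F.homotopy₁ (ψ₀ x) (ψ₁ f))
    have hc := congrArg ψ₀ (F.comm (ψ₁ f))
    rw [h₀, h₁'] at hc
    simp only [map_sub, h₁, h₁', h₀'] at h
    simp only [LinearMap.neg_apply, LinearMap.compr₂_apply, LinearMap.compl₁₂_apply]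
    rw [← hc, ← h]
    abel
  coherence x y z := by
    -- `ψ₀` is compatible with the brackets up to `ψ₁ Φ`.
    have hbr : ∀ u v, ψ₀ (L'.br u v)
        = L.br (ψ₀ u) (ψ₀ v) - L.d (ψ₁ (F.Φ (ψ₀ u) (ψ₀ v))) := fun u v => by
      have h := congrArg ψ₀ (F.homotopy₀ (ψ₀ u) (ψ₀ v))
      have hc := congrArg ψ₀ (F.comm (ψ₁ (F.Φ (ψ₀ u) (ψ₀ v))))
      rw [h₀, h₁'] at hc
      simp only [map_sub, h₀, h₀'] at h
      rw [hc, ← h]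
      abel
    have hbr₁ : ∀ u f, L.br₁ (ψ₀ u) (ψ₁ f)
        = ψ₁ (L'.br₁ u f) + ψ₁ (F.Φ (ψ₀ u) (L.d (ψ₁ f))) := fun u f => by
      have h := congrArg ψ₁ (F.homotopy₁ (ψ₀ u) (ψ₁ f))
      simp only [map_sub, h₁, h₁', h₀'] at h
      rw [← h]
      abel
    have hs : ∀ u f, F.Φ (L.d f) u = -F.Φ u (L.d f) := fun u f => F.skew _ _
    have h := congrArg ψ₁ (F.coherence (ψ₀ x) (ψ₀ y) (ψ₀ z))
    simp only [map_sub, map_add, h₁, h₀'] at h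
    simp only [LinearMap.neg_apply, LinearMap.compr₂_apply, LinearMap.compl₁₂_apply, hbr, map_sub,
      map_neg, hbr₁, LinearMap.sub_apply, hs]
    linear_combination (norm := module) -h

/-- A morphism whose underlying chain map is invertible is an isomorphism. -/
theorem Hom.isomorphic (F : Hom L L') (ψ₀ : L₀' →ₗ[ℝ] L₀) (ψ₁ : L₁' →ₗ[ℝ] L₁)
    (h₀ : ∀ x, ψ₀ (F.φ₀ x) = x) (h₀' : ∀ x, F.φ₀ (ψ₀ x) = x)
    (h₁ : ∀ f, ψ₁ (F.φ₁ f) = f) (h₁' : ∀ f, F.φ₁ (ψ₁ f) = f) : L.Isomorphic L' := by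
  refine ⟨F, F.inverse ψ₀ ψ₁ h₀ h₀' h₁ h₁', ⟨h₀, h₁, fun x y => ?_⟩, ⟨h₀', h₁', fun x y => ?_⟩⟩
  · simp [Hom.inverse, h₀]
  · simp [Hom.inverse, h₁']

end LieTwoOps

/-! ### The Lie 2-algebra of Hamiltonian 1-forms -/

section Hamiltonian

variable {E : Type*} [NormedAddCommGroup E] [NormedSpace ℝ E] [FiniteDimensional ℝ E]
  {M : Type*} [TopologicalSpace M] [ChartedSpace E M] [IsManifold 𝓘(ℝ, E) ∞ M]
  {Ω : ThreeForm E M}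

theorem ThreeForm.ev_zero1 (Ω : ThreeForm E M) (X Y : VField E M) : Ω.ev 0 X Y = 0 := by
  simpa using Ω.ev_smul1 0 X Y 0

theorem ThreeForm.ev_zero2 (Ω : ThreeForm E M) (X Y : VField E M) : Ω.ev X 0 Y = 0 := by
  simpa using Ω.ev_smul2 X 0 Y 0

theorem ThreeForm.ev_rev (Ω : ThreeForm E M) (X Y Z : VField E M) :
    Ω.ev Z Y X = -Ω.ev X Y Z := by
  rw [Ω.ev_swap12, Ω.ev_swap23, Ω.ev_swap12 Y X]
  simp

variable [T2Space M]

variable (Ω) in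
/-- `Ω` is invariant under the flow of `a`, that is, its Lie derivative along `a` vanishes. -/
def ThreeForm.InvariantUnder (a : VField E M) : Prop :=
  ∀ X Y Z, act a (Ω.ev X Y Z)
    = Ω.ev (lie a X) Y Z + Ω.ev X (lie a Y) Z + Ω.ev X Y (lie a Z)

theorem IsHamiltonianField.invariantUnder (hΩ : Ω.IsClosed) {α : OneForm E M} {a : VField E M}
    (ha : IsHamiltonianField Ω α a) : Ω.InvariantUnder a :=
  hΩ.lie_eq (evLin α) a ha

theorem ThreeForm.ev_lie_swap (X Y Z W : VField E M) : Ω.ev (lie X Y) Z W = -Ω.ev (lie Y X) Z W := by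
  rw [lie_skew, ThreeForm.ev_neg1]

theorem ThreeForm.ev_rotate (X Y Z : VField E M) : Ω.ev X Y Z = Ω.ev Z X Y := by
  rw [Ω.ev_swap23, Ω.ev_swap12 X Z Y, neg_neg]

theorem ThreeForm.InvariantUnder.act_ev {a : VField E M} (ha : Ω.InvariantUnder a)
    (X Y Z : VField E M) :
    act a (Ω.ev X Y Z) = Ω.ev (lie a X) Y Z - Ω.ev (lie a Y) X Z + Ω.ev (lie a Z) X Y := by
  rw [ha, Ω.ev_swap12 X (lie a Y) Z, Ω.ev_rotate X Y (lie a Z)]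
  abel

/-- For fields that preserve `Ω`, each derivative in the formula for `dΩ` is a sum of values of `Ω`
on brackets, so that `dΩ = 0` becomes a relation between such values only. -/
theorem ThreeForm.IsClosed.sum_ev_lie (hΩ : Ω.IsClosed) {a b c e : VField E M}
    (ha : Ω.InvariantUnder a) (hb : Ω.InvariantUnder b) (hc : Ω.InvariantUnder c)
    (he : Ω.InvariantUnder e) :
    Ω.ev (lie a b) c e - Ω.ev (lie a c) b e + Ω.ev (lie a e) b c + Ω.ev (lie b c) a e
      - Ω.ev (lie b e) a c + Ω.ev (lie c e) a b = 0 := by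
  have h := hΩ a b c e
  unfold ThreeForm.extDeriv at h
  rw [ha.act_ev, hb.act_ev, hc.act_ev, he.act_ev, Ω.ev_lie_swap b a, Ω.ev_lie_swap c a,
    Ω.ev_lie_swap e a, Ω.ev_lie_swap c b, Ω.ev_lie_swap e b, Ω.ev_lie_swap e c] at h
  linear_combination h

theorem hamField_d (hΩ : Ω.IsTwoPlectic) (f : Fn E M) :
    hamField ((hamiltonianLieTwo hΩ).d f) = 0 :=
  hΩ.nondegenerate.unique (hamField_spec _) (isHamiltonianField_deRham f)

theorem hamField_br (hΩ : Ω.IsTwoPlectic) (α β : HamForm Ω) :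
    hamField ((hamiltonianLieTwo hΩ).br α β) = lie (hamField α) (hamField β) :=
  hΩ.nondegenerate.unique (hamField_spec _)
    (isHamiltonianField_contract hΩ.closed (hamField_spec α) (hamField_spec β))

theorem hamiltonianLieTwo_ev_br (hΩ : Ω.IsTwoPlectic) (α β : HamForm Ω) (X : VField E M) :
    OneForm.ev ((hamiltonianLieTwo hΩ).br α β).1 X = Ω.ev (hamField α) (hamField β) X :=
  Ω.contract_ev _ _ _

theorem hamiltonianLieTwo_J (hΩ : Ω.IsTwoPlectic) (α β γ : HamForm Ω) :
    (hamiltonianLieTwo hΩ).J α β γ = -Ω.ev (hamField α) (hamField β) (hamField γ) :=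
  Ω.ev_rev _ _ _

theorem hamiltonianLieTwo_isLieTwoAlgebra (hΩ : Ω.IsTwoPlectic) :
    (hamiltonianLieTwo hΩ).IsLieTwoAlgebra := by
  have hbr₁ : ∀ x f, (hamiltonianLieTwo hΩ).br₁ x f = 0 := fun _ _ => rfl
  have hinv : ∀ α : HamForm Ω, Ω.InvariantUnder (hamField α) := fun α =>
    (hamField_spec α).invariantUnder hΩ.closed
  refine ⟨fun x y => ?_, fun x f => ?_, fun f g => ?_, fun x y z => ?_, fun x y z => ?_,
    fun x y z => ?_, fun x y f => ?_, fun x y z w => ?_⟩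
  · refine Subtype.ext (OneForm.ext_ev fun X => ?_)
    rw [hamiltonianLieTwo_ev_br, Ω.ev_swap12]
    exact congrArg Neg.neg (hamiltonianLieTwo_ev_br hΩ y x X).symm
  · refine Subtype.ext (OneForm.ext_ev fun X => ?_)
    rw [hamiltonianLieTwo_ev_br, hamField_d, Ω.ev_zero2, hbr₁, map_zero]
    rfl
  · rw [hbr₁, hbr₁, neg_zero]
  · rw [hamiltonianLieTwo_J, hamiltonianLieTwo_J, Ω.ev_swap12]
  · rw [hamiltonianLieTwo_J, hamiltonianLieTwo_J, Ω.ev_swap23]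
  · refine Subtype.ext (OneForm.ext_ev fun X => ?_)
    have hd : OneForm.ev ((hamiltonianLieTwo hΩ).d ((hamiltonianLieTwo hΩ).J x y z)).1 X
        = -act X (Ω.ev (hamField x) (hamField y) (hamField z)) := by
      rw [hamiltonianLieTwo_J, ← act_neg]
      rfl
    rw [hd]
    change OneForm.ev ((hamiltonianLieTwo hΩ).br x ((hamiltonianLieTwo hΩ).br y z)).1 X
      - (OneForm.ev ((hamiltonianLieTwo hΩ).br ((hamiltonianLieTwo hΩ).br x y) z).1 X
        + OneForm.ev ((hamiltonianLieTwo hΩ).br y ((hamiltonianLieTwo hΩ).br x z)).1 X) = _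
    simp only [hamiltonianLieTwo_ev_br, hamField_br]
    have h := hΩ.closed (hamField x) (hamField y) (hamField z) X
    unfold ThreeForm.extDeriv at h
    rw [(hinv x).act_ev, (hinv y).act_ev, (hinv z).act_ev, Ω.ev_lie_swap (hamField y) (hamField x),
      Ω.ev_lie_swap (hamField z) (hamField x), Ω.ev_lie_swap (hamField z) (hamField y)] at h
    rw [Ω.ev_swap12 (hamField x), Ω.ev_swap12 (hamField y) (lie _ _)]
    linear_combination -h
  · rw [hbr₁, hbr₁, hbr₁, hamiltonianLieTwo_J, hamField_d, Ω.ev_rotate, Ω.ev_zero1]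
    simp
  · simp only [hbr₁, hamiltonianLieTwo_J, hamField_br]
    have h := hΩ.closed.sum_ev_lie (hinv x) (hinv y) (hinv z) (hinv w)
    have e1 := Ω.ev_swap12 (hamField x) (lie (hamField y) (hamField z)) (hamField w)
    have e2 := Ω.ev_rotate (hamField x) (hamField z) (lie (hamField y) (hamField w))
    have e3 := Ω.ev_rotate (hamField x) (hamField y) (lie (hamField z) (hamField w))
    have e4 := Ω.ev_swap12 (hamField y) (lie (hamField x) (hamField z)) (hamField w)
    have e5 := Ω.ev_rotate (hamField y) (hamField z) (lie (hamField x) (hamField w))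
    linear_combination h - e1 - e2 + e3 + e4 + e5

end Hamiltonian

/-! ### The section `ρ^* α` of a 1-form -/

section Coanchor

variable {E : Type*} [NormedAddCommGroup E] [NormedSpace ℝ E] [FiniteDimensional ℝ E]
  {M : Type*} [TopologicalSpace M] [ChartedSpace E M] [IsManifold 𝓘(ℝ, E) ∞ M] [T2Space M]

/-- Near every point, a 1-form is a combination `∑ gᵢ dfᵢ` of differentials of globally defined
functions: the `fᵢ` are cut-off coordinates, and `gᵢ = α(Xᵢ)` for cut-off coordinate fields `Xᵢ`. -/
theorem OneForm.exists_eventuallyEq_sum (α : OneForm E M) (x₀ : M) :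
    ∃ g f : Fin (Module.finrank ℝ E) → Fn E M,
      ∀ᶠ x in nhds x₀, α.1 x = ∑ i, g i x • (deRham E M (f i)).1 x := by
  let b := Module.finBasis ℝ E
  let c : Fin (Module.finrank ℝ E) → (E →L[ℝ] ℝ) := fun i =>
    LinearMap.toContinuousLinearMap (b.coord i)
  let t := trivializationAt E (TangentSpace 𝓘(ℝ, E) : M → Type _) x₀
  choose X hX using fun i => Twisted.exists_section_eventuallyEq (E := E) (F := E)
    (V := (TangentSpace 𝓘(ℝ, E) : M → Type _)) x₀ (t.symm x₀ (b i))
  obtain ⟨ψ⟩ : Nonempty (SmoothBumpFunction 𝓘(ℝ, E) x₀) := inferInstance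
  let f : Fin (Module.finrank ℝ E) → Fn E M := fun i =>
    ⟨fun x => ψ x • c i (extChartAt 𝓘(ℝ, E) x₀ x), ψ.contMDiff_smul
      ((c i).contMDiff.comp_contMDiffOn (contMDiffOn_extChartAt (n := ∞)))⟩
  refine ⟨fun i => OneForm.ev α (X i), f, ?_⟩
  filter_upwards [Filter.eventually_all.2 hX, ψ.eventuallyEq_one.eventuallyEq_nhds,
    t.open_baseSet.mem_nhds (FiberBundle.mem_baseSet_trivializationAt' x₀),
    (chartAt E x₀).open_source.mem_nhds (mem_chart_source E x₀)] with x hx hψ hxt hxs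
  have hdf : ∀ i (v : TangentSpace 𝓘(ℝ, E) x), (deRham E M (f i)).1 x v
      = b.coord i (t.continuousLinearMapAt ℝ x v) := by
    intro i v
    have hfx : (f i : M → ℝ) =ᶠ[nhds x] c i ∘ extChartAt 𝓘(ℝ, E) x₀ := by
      filter_upwards [hψ] with y hy
      change ψ y • c i (extChartAt 𝓘(ℝ, E) x₀ y) = _
      rw [hy]; simp
    have hm := mfderiv_comp x (c i).mdifferentiableAt
      (mdifferentiableAt_extChartAt (I := 𝓘(ℝ, E)) hxs)
    rw [(c i).mfderiv_eq, ← hfx.mfderiv_eq, 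
      ← TangentBundle.continuousLinearMapAt_trivializationAt hxs] at hm
    exact congrArg (fun L => L v) hm
  ext v
  have hv : v = ∑ i, b.coord i (t.continuousLinearMapAt ℝ x v) • X i x := by
    have hXx : ∀ i, X i x = t.symmL ℝ x (b i) := by
      intro i
      rw [hx i]
      have h := t.apply_mk_symm (FiberBundle.mem_baseSet_trivializationAt' x₀) (b i)
      simp only [FiberBundle.extend]
      rw [Bundle.Trivialization.symmL_apply (hb := hxt)]
      exact congrArg (fun p => t.symm x p.2) h
    simp only [hXx, ← map_smul, ← map_sum]
    rw [show ∑ i, b.coord i (t.continuousLinearMapAt ℝ x v) • b i = t.continuousLinearMapAt ℝ x v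
      from b.sum_repr _, t.symmL_continuousLinearMapAt (R := ℝ) hxt v]
  conv_lhs => rw [hv]
  rw [map_sum, sum_apply]
  refine Finset.sum_congr rfl fun i _ => ?_
  rw [map_smul, smul_eq_mul, mul_comm]
  exact congrArg _ (hdf i v).symm

variable {F : Type*} [NormedAddCommGroup F] [NormedSpace ℝ F] [FiniteDimensional ℝ F]
  {V : M → Type*} [TopologicalSpace (Bundle.TotalSpace F V)] [∀ x, TopologicalSpace (V x)]
  [∀ x, AddCommGroup (V x)] [∀ x, Module ℝ (V x)] [FiberBundle F V] [VectorBundle ℝ F V]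
  [ContMDiffVectorBundle ∞ F V 𝓘(ℝ, E)]

namespace CourantAlgebroid

/-- The section `ρ^* α` of a Courant algebroid. It is smooth because it is locally `∑ gᵢ D fᵢ`, where
`α = ∑ gᵢ dfᵢ`. -/
noncomputable def coanchorSec (C : CourantAlgebroid E F V) (α : OneForm E M) : Cₛ^∞⟮𝓘(ℝ, E); F, V⟯ :=
  ⟨fun x => C.coanchor x (α.1 x), fun x₀ => by
    obtain ⟨g, f, h⟩ := α.exists_eventuallyEq_sum x₀
    have hs : ContMDiffAt 𝓘(ℝ, E) (𝓘(ℝ, E).prod 𝓘(ℝ, F)) ∞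
        (fun x => (⟨x, ∑ i, g i x • C.D (f i) x⟩ : Bundle.TotalSpace F V)) x₀ :=
      ContMDiffAt.sum_section fun i _ =>
        ContMDiffAt.smul_section (g i).contMDiff.contMDiffAt (C.D (f i)).contMDiff.contMDiffAt
    refine hs.congr_of_eventuallyEq ?_
    filter_upwards [h] with x hx
    rw [hx, map_sum]
    simp only [map_smul, C.D_eq]
    rfl⟩

theorem pair_coanchorSec (C : CourantAlgebroid E F V) (α : OneForm E M)
    (e : Cₛ^∞⟮𝓘(ℝ, E); F, V⟯) : C.pair (C.coanchorSec α) e = OneForm.ev α (C.rho e) := by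
  ext x
  exact C.form_coanchor x _ _

theorem rho_coanchorSec {C : CourantAlgebroid E F V} (hC : C.IsExact) (α : OneForm E M) :
    C.rho (C.coanchorSec α) = 0 := by
  ext x
  exact (hC.exact x _).2 ⟨_, rfl⟩

end CourantAlgebroid

end Coanchor

/-! ### Sections that preserve a splitting -/

section Preserving

variable {E : Type*} [NormedAddCommGroup E] [NormedSpace ℝ E] [FiniteDimensional ℝ E]
  {M : Type*} [TopologicalSpace M] [ChartedSpace E M] [IsManifold 𝓘(ℝ, E) ∞ M]
  {F : Type*} [NormedAddCommGroup F] [NormedSpace ℝ F] [FiniteDimensional ℝ F]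
  {V : M → Type*} [TopologicalSpace (Bundle.TotalSpace F V)] [∀ x, TopologicalSpace (V x)]
  [∀ x, AddCommGroup (V x)] [∀ x, Module ℝ (V x)] [FiberBundle F V] [VectorBundle ℝ F V]
  {C : CourantAlgebroid E F V}

namespace CourantAlgebroid.Splitting

/-- The 1-form `⟨e, s(·)⟩` of a section `e`. -/
noncomputable def toForm (s : C.Splitting) : Cₛ^∞⟮𝓘(ℝ, E); F, V⟯ →ₗ[ℝ] OneForm E M where
  toFun e := ⟨fun x => (LinearMap.toContinuousLinearMap
      (show E →ₗ[ℝ] ℝ from (C.form x (e x)) ∘ₗ s.toFun x) : E →L[ℝ] ℝ),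
    fun X => (C.pair e (s.lift X)).contMDiff⟩
  map_add' a b := OneForm.ext_pt fun x v => by
    change C.form x ((a + b) x) (s.toFun x v) = C.form x (a x) _ + C.form x (b x) _
    simp
    rfl
  map_smul' r a := OneForm.ext_pt fun x v => by
    change C.form x (r • a x) (s.toFun x v) = r * C.form x (a x) (s.toFun x v)
    rw [map_smul, LinearMap.smul_apply, smul_eq_mul]

theorem ev_toForm (s : C.Splitting) (e : Cₛ^∞⟮𝓘(ℝ, E); F, V⟯) (X : VField E M) :
    OneForm.ev (s.toForm e) X = C.pair e (s.lift X) := rfl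

/-- Under the decomposition `e = s(ρ(e)) + ρ^* ⟨e, s(·)⟩` the pairing is the standard one of
`TM ⊕ T^*M`. -/
theorem pair_eq (hC : C.IsExact) (s : C.Splitting) (e e' : Cₛ^∞⟮𝓘(ℝ, E); F, V⟯) :
    C.pair e e' = OneForm.ev (s.toForm e) (C.rho e') + OneForm.ev (s.toForm e') (C.rho e) := by
  have h : C.pair (e - s.lift (C.rho e)) (e' - s.lift (C.rho e')) = 0 :=
    pair_ker hC (by rw [map_sub, s.rho_lift, sub_self]) (by rw [map_sub, s.rho_lift, sub_self])
  simp only [map_sub, LinearMap.sub_apply, s.pair_lift_lift, C.pair_symm (s.lift _) e'] at h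
  rw [ev_toForm, ev_toForm]
  linear_combination h

theorem toForm_D (s : C.Splitting) (f : Fn E M) : s.toForm (C.D f) = deRham E M f :=
  OneForm.ext_pt fun x v => by
    change C.form x (C.D f x) (s.toFun x v) = diff E f x v
    rw [C.D_eq, C.form_coanchor, s.anchor_toFun]

variable [T2Space M] {s : C.Splitting} {Ω : ThreeForm E M}

theorem ext_toForm (hC : C.IsExact) {e e' : Cₛ^∞⟮𝓘(ℝ, E); F, V⟯} (h : C.rho e = C.rho e')
    (h' : s.toForm e = s.toForm e') : e = e' :=
  s.eq_of_pair_lift hC h fun X => congrArg (fun α => OneForm.ev α X) h'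

/-- A section preserves the splitting iff its 1-form is Hamiltonian, with its vector field as the
Hamiltonian vector field. -/
theorem mem_preserving_iff_isHamiltonianField (hC : C.IsExact) (hs : s.HasCurvatureNeg Ω)
    (e : Cₛ^∞⟮𝓘(ℝ, E); F, V⟯) :
    e ∈ s.preserving ↔ IsHamiltonianField Ω (s.toForm e) (C.rho e) :=
  mem_preserving_iff hC hs e

/-- The bracket of sections `X + α`, `Y + β` that preserve the splitting has the 1-form
`ι_Y ι_X Ω + ½ d(β(X) - α(Y))`. -/
theorem ev_toForm_bracket (hC : C.IsExact) {e₁ e₂ : Cₛ^∞⟮𝓘(ℝ, E); F, V⟯}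
    (h₁ : e₁ ∈ s.preserving) (h₂ : IsHamiltonianField Ω (s.toForm e₂) (C.rho e₂))
    (X : VField E M) :
    OneForm.ev (s.toForm (C.bracket e₁ e₂)) X = Ω.ev (C.rho e₁) (C.rho e₂) X
      + (1 / 2 : ℝ) • act X (OneForm.ev (s.toForm e₂) (C.rho e₁)
        - OneForm.ev (s.toForm e₁) (C.rho e₂)) := by
  have h := C.dorfman_invariance e₁ e₂ (s.lift X)
  rw [h₁ X, dorfman_apply, map_add, LinearMap.add_apply, map_smul, LinearMap.smul_apply, C.pair_D,
    s.rho_lift, pair_eq hC s e₁ e₂, act_add] at h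
  have h2 := h₂ (C.rho e₁) X
  rw [Ω.ev_swap12] at h2
  simp only [OneForm.extDeriv, ev_toForm] at h h2 ⊢
  rw [act_sub]
  linear_combination (norm := module) h2 - h

/-- The Jacobiator of `L_∞(C)` on sections `X + α`, `Y + β`, `Z + γ` that preserve the splitting is
`-Ω(X, Y, Z) - ¼ (X(γ(Y)) - Y(γ(X)) + cyclic)`. -/
theorem lieTwo_J (hC : C.IsExact) (hs : s.HasCurvatureNeg Ω) {x y z : Cₛ^∞⟮𝓘(ℝ, E); F, V⟯}
    (hx : x ∈ s.preserving) (hy : y ∈ s.preserving) (hz : z ∈ s.preserving) :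
    C.lieTwo.J x y z = -Ω.ev (C.rho x) (C.rho y) (C.rho z) - (1 / 4 : ℝ) •
      (act (C.rho x) (OneForm.ev (s.toForm z) (C.rho y))
        - act (C.rho y) (OneForm.ev (s.toForm z) (C.rho x))
        + act (C.rho y) (OneForm.ev (s.toForm x) (C.rho z))
        - act (C.rho z) (OneForm.ev (s.toForm x) (C.rho y))
        + act (C.rho z) (OneForm.ev (s.toForm y) (C.rho x))
        - act (C.rho x) (OneForm.ev (s.toForm y) (C.rho z))) := by
  have hx' := (mem_preserving_iff_isHamiltonianField hC hs x).1 hx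
  have hy' := (mem_preserving_iff_isHamiltonianField hC hs y).1 hy
  have hz' := (mem_preserving_iff_isHamiltonianField hC hs z).1 hz
  change -((1 / 6 : ℝ) • (C.pair (C.bracket x y) z + C.pair (C.bracket z x) y
    + C.pair (C.bracket y z) x)) = _
  rw [pair_eq hC s _ z, pair_eq hC s _ y, pair_eq hC s _ x, ev_toForm_bracket hC hx hy',
    ev_toForm_bracket hC hz hx', ev_toForm_bracket hC hy hz', C.rho_bracket, C.rho_bracket,
    C.rho_bracket, ← Ω.ev_rotate (C.rho x), Ω.ev_rotate (C.rho y) (C.rho z)]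
  have a1 := hz' (C.rho x) (C.rho y)
  have a2 := hy' (C.rho z) (C.rho x)
  have a3 := hx' (C.rho y) (C.rho z)
  rw [← Ω.ev_rotate (C.rho x)] at a1
  rw [Ω.ev_rotate (C.rho y)] at a2
  simp only [OneForm.extDeriv] at a1 a2 a3
  simp only [act_sub]
  linear_combination (norm := module) (1 / 6 : ℝ) • (a1 + a2 + a3)

end CourantAlgebroid.Splitting

end Preserving

/-! ### The Lie 2-algebra of sections that preserve a splitting, and the isomorphism -/

section PreservingLieTwo

variable {E : Type*} [NormedAddCommGroup E] [NormedSpace ℝ E] [FiniteDimensional ℝ E]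
  {M : Type*} [TopologicalSpace M] [ChartedSpace E M] [IsManifold 𝓘(ℝ, E) ∞ M] [T2Space M]
  {F : Type*} [NormedAddCommGroup F] [NormedSpace ℝ F] [FiniteDimensional ℝ F]
  {V : M → Type*} [TopologicalSpace (Bundle.TotalSpace F V)] [∀ x, TopologicalSpace (V x)]
  [∀ x, AddCommGroup (V x)] [∀ x, Module ℝ (V x)] [FiberBundle F V] [VectorBundle ℝ F V]
  {C : CourantAlgebroid E F V} {s : C.Splitting} {Ω : ThreeForm E M}

namespace CourantAlgebroid

open Splitting

theorem lieTwo_br₁ (C : CourantAlgebroid E F V) (e : Cₛ^∞⟮𝓘(ℝ, E); F, V⟯) (f : Fn E M) :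
    C.lieTwo.br₁ e f = (1 / 2 : ℝ) • act (C.rho e) f := by
  rw [← C.pair_D, C.pair_symm]
  rfl

theorem lieTwo_J_swap₁₂ (C : CourantAlgebroid E F V) (x y z : Cₛ^∞⟮𝓘(ℝ, E); F, V⟯) :
    C.lieTwo.J x y z = -C.lieTwo.J y x z := by
  change -((1 / 6 : ℝ) • (C.pair (C.bracket x y) z + C.pair (C.bracket z x) y
    + C.pair (C.bracket y z) x)) = - -((1 / 6 : ℝ) • (C.pair (C.bracket y x) z
    + C.pair (C.bracket z y) x + C.pair (C.bracket x z) y))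
  rw [C.skew y x, C.skew z y, C.skew x z]
  simp only [map_neg, LinearMap.neg_apply]
  module

theorem lieTwo_J_swap₂₃ (C : CourantAlgebroid E F V) (x y z : Cₛ^∞⟮𝓘(ℝ, E); F, V⟯) :
    C.lieTwo.J x y z = -C.lieTwo.J x z y := by
  change -((1 / 6 : ℝ) • (C.pair (C.bracket x y) z + C.pair (C.bracket z x) y
    + C.pair (C.bracket y z) x)) = - -((1 / 6 : ℝ) • (C.pair (C.bracket x z) y
    + C.pair (C.bracket y x) z + C.pair (C.bracket z y) x))
  rw [C.skew y x, C.skew z y, C.skew x z]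
  simp only [map_neg, LinearMap.neg_apply]
  module

/-- The coherence law of `L_∞(C)` on sections that preserve the splitting. In terms of the vector
fields and 1-forms of the sections, all terms are second derivatives of the functions `αᵢ(vⱼ)` or
derivatives of the functions `Ω(vᵢ, vⱼ, vₖ)`. As the `vᵢ` preserve `Ω`, the latter are sums of values
of `Ω` on brackets, and everything cancels. -/
theorem lieTwo_coherence (hΩ : Ω.IsClosed) (hC : C.IsExact) (hs : s.HasCurvatureNeg Ω)
    {x y z w : Cₛ^∞⟮𝓘(ℝ, E); F, V⟯} (hx : x ∈ s.preserving) (hy : y ∈ s.preserving)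
    (hz : z ∈ s.preserving) (hw : w ∈ s.preserving) :
    C.lieTwo.br₁ x (C.lieTwo.J y z w) + C.lieTwo.J x (C.bracket y z) w
        + C.lieTwo.J x z (C.bracket y w) - C.lieTwo.br₁ w (C.lieTwo.J x y z)
        + C.lieTwo.br₁ z (C.lieTwo.J x y w)
      = C.lieTwo.J x y (C.bracket z w) + C.lieTwo.J (C.bracket x y) z w
        + C.lieTwo.br₁ y (C.lieTwo.J x z w) + C.lieTwo.J y (C.bracket x z) w
        + C.lieTwo.J y z (C.bracket x w) := by
  have hx' := (mem_preserving_iff_isHamiltonianField hC hs x).1 hx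
  have hy' := (mem_preserving_iff_isHamiltonianField hC hs y).1 hy
  have hz' := (mem_preserving_iff_isHamiltonianField hC hs z).1 hz
  have hw' := (mem_preserving_iff_isHamiltonianField hC hs w).1 hw
  have hbr : ∀ {u v}, u ∈ s.preserving → v ∈ s.preserving → C.bracket u v ∈ s.preserving :=
    fun hu hv => bracket_mem_preserving hΩ hC hs hu hv
  rw [lieTwo_J hC hs hy hz hw, lieTwo_J hC hs hx (hbr hy hz) hw,
    lieTwo_J hC hs hx hz (hbr hy hw), lieTwo_J hC hs hx hy hz, lieTwo_J hC hs hx hy hw,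
    lieTwo_J hC hs hx hy (hbr hz hw), lieTwo_J hC hs (hbr hx hy) hz hw,
    lieTwo_J hC hs hx hz hw, lieTwo_J hC hs hy (hbr hx hz) hw, lieTwo_J hC hs hy hz (hbr hx hw)]
  simp only [lieTwo_br₁, ev_toForm_bracket hC hx hy', ev_toForm_bracket hC hx hz',
    ev_toForm_bracket hC hx hw', ev_toForm_bracket hC hy hz', ev_toForm_bracket hC hy hw',
    ev_toForm_bracket hC hz hw', C.rho_bracket]
  have ev_lie : ∀ {α : OneForm E M} {a : VField E M}, IsHamiltonianField Ω α a → ∀ X Y,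
      OneForm.ev α (lie X Y) = act X (OneForm.ev α Y) - act Y (OneForm.ev α X) + Ω.ev a X Y := by
    intro α a h X Y
    have h1 := h X Y
    simp only [OneForm.extDeriv] at h1
    linear_combination -h1
  simp only [ev_lie hx', ev_lie hy', ev_lie hz', ev_lie hw']
  replace hx' := hx'.invariantUnder hΩ
  replace hy' := hy'.invariantUnder hΩ
  replace hz' := hz'.invariantUnder hΩ
  replace hw' := hw'.invariantUnder hΩ
  generalize s.toForm x = α, s.toForm y = β, s.toForm z = γ, s.toForm w = δ
  generalize C.rho x = a at *
  generalize C.rho y = b at *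
  generalize C.rho z = c at *
  generalize C.rho w = e at *
  -- Sort the arguments of `Ω` in the order `a, b, c, e`, with brackets in front.
  have perm : ∀ p q r : VField E M, Ω.ev q r p = Ω.ev p q r ∧ Ω.ev r p q = Ω.ev p q r ∧
      Ω.ev p r q = -Ω.ev p q r ∧ Ω.ev q p r = -Ω.ev p q r ∧ Ω.ev r q p = -Ω.ev p q r :=
    fun p q r => ⟨Ω.ev_rotate q r p, (Ω.ev_rotate p q r).symm, Ω.ev_swap23 p r q,
      Ω.ev_swap12 q p r, Ω.ev_rev p q r⟩
  simp only [perm a b c, perm a b e, perm a c e, perm b c e, Ω.ev_swap12 a (lie b c),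
    Ω.ev_swap12 b (lie a c), Ω.ev_rotate a c (lie b e), Ω.ev_rotate a b (lie c e),
    Ω.ev_rotate b c (lie a e), act_sub, act_add, act_neg, act_smul, act_lie, hx'.act_ev,
    hy'.act_ev, hz'.act_ev, hw'.act_ev, Ω.ev_lie_swap b a, Ω.ev_lie_swap c a, Ω.ev_lie_swap e a,
    Ω.ev_lie_swap c b, Ω.ev_lie_swap e b, Ω.ev_lie_swap e c]
  module

theorem preservingLieTwo_isLieTwoAlgebra (hΩ : Ω.IsClosed) (hC : C.IsExact)
    (hs : s.HasCurvatureNeg Ω) : (preservingLieTwo hΩ hC hs).IsLieTwoAlgebra where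
  skew x y := Subtype.ext (C.skew x.1 y.1)
  d_br₁ x f := by
    refine Subtype.ext ?_
    change C.D (C.lieTwo.br₁ x.1 f) = C.bracket x.1 (C.D f)
    have hf := (mem_preserving_iff_isHamiltonianField hC hs _).1 (D_mem_preserving hC hs f)
    refine ext_toForm (s := s) hC ?_ (OneForm.ext_ev fun X => ?_)
    · rw [rho_D hC, C.rho_bracket, rho_D hC]
      simpa using (lie_smul_right 0 (C.rho x.1) 0).symm
    · rw [ev_toForm_bracket hC x.2 hf, toForm_D, toForm_D, rho_D hC, Ω.ev_zero2, OneForm.ev_deRham,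
        OneForm.ev_deRham, lieTwo_br₁, act_smul, Twisted.ev_zero]
      simp
  br₁_d f g := by
    change (1 / 2 : ℝ) • C.pair (C.D f) (C.D g) = -((1 / 2 : ℝ) • C.pair (C.D g) (C.D f))
    rw [C.pair_D_D, C.pair_D_D]
    simp
  J_skew₁₂ x y z := C.lieTwo_J_swap₁₂ x.1 y.1 z.1
  J_skew₂₃ x y z := C.lieTwo_J_swap₂₃ x.1 y.1 z.1
  d_J x y z := by
    refine Subtype.ext ?_
    have h := C.jacobi x.1 y.1 z.1
    rw [← map_neg, sub_sub] at h
    exact h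
  J_d x y f := by
    change C.lieTwo.br₁ x.1 (C.lieTwo.br₁ y.1 f) - (C.lieTwo.br₁ (C.bracket x.1 y.1) f
      + C.lieTwo.br₁ y.1 (C.lieTwo.br₁ x.1 f)) = C.lieTwo.J x.1 y.1 (C.D f)
    have h0 : ∀ X : VField E M, act X (0 : Fn E M) = 0 := fun X => by simpa using act_smul X 0 0
    rw [lieTwo_J hC hs x.2 y.2 (D_mem_preserving hC hs f)]
    simp only [lieTwo_br₁, rho_D hC, toForm_D, OneForm.ev_deRham, act_zero_left, Twisted.ev_zero,
      C.rho_bracket, act_lie, act_smul, Ω.ev_rotate _ _ 0, Ω.ev_zero1, h0]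
    module
  coherence x y z w := lieTwo_coherence hΩ hC hs x.2 y.2 z.2 w.2

variable [ContMDiffVectorBundle ∞ F V 𝓘(ℝ, E)]

/-- The section `s(v_α) + ρ^* α` that corresponds to a Hamiltonian 1-form `α`. -/
noncomputable def Splitting.ofHamForm (s : C.Splitting) (α : HamForm Ω) : Cₛ^∞⟮𝓘(ℝ, E); F, V⟯ :=
  s.lift (hamField α) + C.coanchorSec α.1

theorem Splitting.rho_ofHamForm (hC : C.IsExact) (α : HamForm Ω) :
    C.rho (s.ofHamForm α) = hamField α := by
  rw [ofHamForm, map_add, s.rho_lift, rho_coanchorSec hC, add_zero]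

theorem Splitting.toForm_ofHamForm (α : HamForm Ω) : s.toForm (s.ofHamForm α) = α.1 :=
  OneForm.ext_ev fun X => by
    rw [ev_toForm, ofHamForm, map_add, LinearMap.add_apply, s.pair_lift_lift, pair_coanchorSec,
      s.rho_lift, zero_add]

theorem Splitting.ofHamForm_mem (hC : C.IsExact) (hs : s.HasCurvatureNeg Ω) (α : HamForm Ω) :
    s.ofHamForm α ∈ s.preserving := by
  rw [mem_preserving_iff_isHamiltonianField hC hs, toForm_ofHamForm, rho_ofHamForm hC]
  exact hamField_spec α

/-- Hamiltonian 1-forms correspond to the sections that preserve the splitting, by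
`α ↦ s(v_α) + ρ^* α` and `e ↦ ⟨e, s(·)⟩`. -/
noncomputable def hamFormEquiv (hΩ : Ω.IsNondegenerate) (hC : C.IsExact)
    (hs : s.HasCurvatureNeg Ω) : HamForm Ω ≃ₗ[ℝ] s.preserving :=
  LinearEquiv.symm
    { toFun := fun e => ⟨s.toForm e.1, C.rho e.1,
        (mem_preserving_iff_isHamiltonianField hC hs e.1).1 e.2⟩
      map_add' := fun a b => Subtype.ext (map_add s.toForm a.1 b.1)
      map_smul' := fun c a => Subtype.ext (map_smul s.toForm c a.1)
      invFun := fun α => ⟨s.ofHamForm α, ofHamForm_mem hC hs α⟩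
      left_inv := fun e => Subtype.ext (ext_toForm (s := s) hC
        ((rho_ofHamForm hC _).trans (hΩ.unique (hamField_spec _)
          ((mem_preserving_iff_isHamiltonianField hC hs e.1).1 e.2)))
        (toForm_ofHamForm _))
      right_inv := fun α => Subtype.ext (toForm_ofHamForm α) }

theorem rho_hamFormEquiv (hΩ : Ω.IsNondegenerate) (hC : C.IsExact) (hs : s.HasCurvatureNeg Ω)
    (α : HamForm Ω) : C.rho (hamFormEquiv hΩ hC hs α).1 = hamField α :=
  rho_ofHamForm hC α

theorem toForm_hamFormEquiv (hΩ : Ω.IsNondegenerate) (hC : C.IsExact) (hs : s.HasCurvatureNeg Ω)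
    (α : HamForm Ω) : s.toForm (hamFormEquiv hΩ hC hs α).1 = α.1 :=
  toForm_ofHamForm α

/-- The morphism `L_∞(M, Ω) → L_∞(C)^s` given by `α ↦ s(v_α) + ρ^* α`, the identity of `C^∞(M)`, and
the chain homotopy `Φ(α, β) = ½ (α(v_β) - β(v_α))`, whose differential is the correction term of
`ev_toForm_bracket` up to sign. -/
noncomputable def hamiltonianHom (hΩ : Ω.IsTwoPlectic) (hC : C.IsExact)
    (hs : s.HasCurvatureNeg Ω) :
    (hamiltonianLieTwo hΩ).Hom (preservingLieTwo hΩ.closed hC hs) where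
  φ₀ := (hamFormEquiv hΩ.nondegenerate hC hs).toLinearMap
  φ₁ := LinearMap.id
  Φ := LinearMap.mk₂ ℝ
    (fun α β => (1 / 2 : ℝ) • (OneForm.ev α.1 (hamField β) - OneForm.ev β.1 (hamField α)))
    (fun α α' β => by
      rw [hamField_add hΩ.nondegenerate, OneForm.ev_add, Submodule.coe_add, OneForm.ev_add_left]
      module)
    (fun c α β => by
      rw [hamField_smul hΩ.nondegenerate, OneForm.ev_smul, Submodule.coe_smul,
        OneForm.ev_smul_left]
      module)
    (fun α β β' => by
      rw [hamField_add hΩ.nondegenerate, OneForm.ev_add, Submodule.coe_add, OneForm.ev_add_left]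
      module)
    (fun c α β => by
      rw [hamField_smul hΩ.nondegenerate, OneForm.ev_smul, Submodule.coe_smul,
        OneForm.ev_smul_left]
      module)
  comm f := Subtype.ext (ext_toForm (s := s) hC
    (by
      change C.rho (hamFormEquiv hΩ.nondegenerate hC hs _).1 = C.rho (C.D f)
      rw [rho_hamFormEquiv, rho_D hC, hamField_d])
    (by
      change s.toForm (hamFormEquiv hΩ.nondegenerate hC hs _).1 = s.toForm (C.D f)
      rw [toForm_hamFormEquiv, toForm_D]
      rfl))
  skew α β := by
    simp only [LinearMap.mk₂_apply]
    module
  homotopy₀ α β := by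
    refine Subtype.ext ?_
    have hβ := (mem_preserving_iff_isHamiltonianField hC hs _).1
      (hamFormEquiv hΩ.nondegenerate hC hs β).2
    change (hamFormEquiv hΩ.nondegenerate hC hs _).1
      - C.bracket (hamFormEquiv hΩ.nondegenerate hC hs α).1
        (hamFormEquiv hΩ.nondegenerate hC hs β).1 = C.D _
    refine ext_toForm (s := s) hC ?_ (OneForm.ext_ev fun X => ?_)
    · rw [map_sub, C.rho_bracket, rho_hamFormEquiv, rho_hamFormEquiv, rho_hamFormEquiv, rho_D hC,
        hamField_br, sub_self]
    · rw [map_sub, Twisted.ev_sub_left,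
        ev_toForm_bracket hC (hamFormEquiv hΩ.nondegenerate hC hs α).2 hβ, toForm_D]
      simp only [toForm_hamFormEquiv, rho_hamFormEquiv, hamiltonianLieTwo_ev_br,
        OneForm.ev_deRham, LinearMap.mk₂_apply, act_smul, act_sub]
      module
  homotopy₁ α f := by
    change (0 : Fn E M) - C.lieTwo.br₁ (hamFormEquiv hΩ.nondegenerate hC hs α).1 f
      = (1 / 2 : ℝ) • (OneForm.ev α.1 (hamField ((hamiltonianLieTwo hΩ).d f))
        - OneForm.ev (deRham E M f) (hamField α))
    rw [lieTwo_br₁, rho_hamFormEquiv, hamField_d, Twisted.ev_zero, OneForm.ev_deRham]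
    module
  coherence α β γ := by
    change (hamiltonianLieTwo hΩ).J α β γ - C.lieTwo.J (hamFormEquiv hΩ.nondegenerate hC hs α).1
        (hamFormEquiv hΩ.nondegenerate hC hs β).1 (hamFormEquiv hΩ.nondegenerate hC hs γ).1
      = _ - _ - _ + C.lieTwo.br₁ (hamFormEquiv hΩ.nondegenerate hC hs γ).1 _
        + C.lieTwo.br₁ (hamFormEquiv hΩ.nondegenerate hC hs α).1 _
        - C.lieTwo.br₁ (hamFormEquiv hΩ.nondegenerate hC hs β).1 _
    rw [lieTwo_J hC hs (hamFormEquiv hΩ.nondegenerate hC hs α).2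
      (hamFormEquiv hΩ.nondegenerate hC hs β).2 (hamFormEquiv hΩ.nondegenerate hC hs γ).2]
    simp only [toForm_hamFormEquiv, rho_hamFormEquiv, lieTwo_br₁, hamiltonianLieTwo_J,
      LinearMap.mk₂_apply, hamiltonianLieTwo_ev_br, hamField_br, act_smul, act_sub]
    have h1 := hamField_spec α (hamField β) (hamField γ)
    have h2 := hamField_spec β (hamField α) (hamField γ)
    have h3 := hamField_spec γ (hamField α) (hamField β)
    rw [Ω.ev_swap12 (hamField β)] at h2
    rw [← Ω.ev_rotate (hamField α)] at h3
    rw [Ω.ev_rotate (hamField β) (hamField γ), Ω.ev_swap23 (hamField α) (hamField γ)]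
    simp only [OneForm.extDeriv] at h1 h2 h3
    linear_combination (norm := module) (1 / 2 : ℝ) • (h1 - h2 + h3)

end CourantAlgebroid

end PreservingLieTwo

end TwoPlectic


theorem proposition7p6 {E : Type*} [NormedAddCommGroup E] [NormedSpace ℝ E] [FiniteDimensional ℝ E]
    {M : Type*} [TopologicalSpace M] [ChartedSpace E M] [IsManifold 𝓘(ℝ, E) ∞ M] [T2Space M]
    (Ω : TwoPlectic.ThreeForm E M) (hΩ : Ω.IsTwoPlectic) :
    (∃ (C : TwoPlectic.CourantAlgebroid E (E × (E →L[ℝ] ℝ)) (TwoPlectic.Twisted.TT E M))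
      (s : C.Splitting), C.IsExact ∧ s.HasCurvatureNeg Ω) ∧
    ∀ {F : Type*} [NormedAddCommGroup F] [NormedSpace ℝ F] [FiniteDimensional ℝ F]
      {V : M → Type*} [TopologicalSpace (Bundle.TotalSpace F V)] [∀ x, TopologicalSpace (V x)]
      [∀ x, AddCommGroup (V x)] [∀ x, Module ℝ (V x)] [FiberBundle F V] [VectorBundle ℝ F V]
      [ContMDiffVectorBundle ∞ F V 𝓘(ℝ, E)]
      (C : TwoPlectic.CourantAlgebroid E F V) (hC : C.IsExact) (s : C.Splitting)
      (hs : s.HasCurvatureNeg Ω),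
      (TwoPlectic.hamiltonianLieTwo hΩ).IsLieTwoAlgebra ∧
      (TwoPlectic.CourantAlgebroid.preservingLieTwo hΩ.closed hC hs).IsLieTwoAlgebra ∧
      (TwoPlectic.hamiltonianLieTwo hΩ).Isomorphic
        (TwoPlectic.CourantAlgebroid.preservingLieTwo hΩ.closed hC hs) := by
  refine ⟨TwoPlectic.Twisted.exists_courant Ω hΩ.closed, ?_⟩
  intro F _ _ _ V _ _ _ _ _ _ _ C hC s hs
  refine ⟨TwoPlectic.hamiltonianLieTwo_isLieTwoAlgebra hΩ,
    TwoPlectic.CourantAlgebroid.preservingLieTwo_isLieTwoAlgebra hΩ.closed hC hs, ?_⟩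
  exact (TwoPlectic.CourantAlgebroid.hamiltonianHom hΩ hC hs).isomorphic
    (TwoPlectic.CourantAlgebroid.hamFormEquiv hΩ.nondegenerate hC hs).symm.toLinearMap
    LinearMap.id (LinearEquiv.symm_apply_apply _) (LinearEquiv.apply_symm_apply _)
    (fun _ => rfl) (fun _ => rfl)
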